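/- Let $n\ge 1$ and let $\lambda=(\lambda_1>\lambda_2>\dots>\lambda_{n-1}>\lambda_n=0)$ be a partition (a regular dominant weight of type $A_{n-1}$). Let $q,t$ be elements of a field with $t\neq 0$ and $q^at^b\ne 1$ for all integers $a,b\ge 1$ (for instance, independent indeterminates over $\mathbb{Q}$). **Fillings.** Identify $\lambda$ with the set of cells $\{(i,j): 1\le i\le n,\ 1\le j\le\lambda_i\}$, let $\lambda'_j=|\{i:\lambda_i\ge j\}|$, and put $n(\lambda)=\sum_i(i-1)\lambda_i$. For a cell $u=(i,j)$ let $\mathrm{arm}(u)=\lambda_i-j$ and $\mathrm{leg}(u)=\lambda'_j-i$. Two cells attack each other if they are distinct cells $(i,j),(k,j)$ of one column, or are of the form $(i,j),(k,j-1)$ with $i<k$. A filling $\sigma:\lambda\to[n]$ is nonattacking if $\sigma(u)\neq\sigma(v)$ whenever $u,v$ attack each other. Let $\mathrm{Des}(\sigma)$ (respectively $\mathrm{Diff}(\sigma)$) be the set of cells $(i,j)$ with $(i,j+1)\in\lambda$ and $\sigma(i,j)>\sigma(i,j+1)$ (respectively $\sigma(i,j)\ne\sigma(i,j+1)$). In the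 reading order, $(i,j)$ precedes $(i',j')$ if $j<j'$, or $j=j'$ and $i<i'$. Let $\mathrm{Inv}(\sigma)$ be the set of pairs $(u,v)$ of attacking cells with $u$ preceding $v$ and $\sigma(u)>\sigma(v)$. Put $\mathrm{maj}(\sigma)=\sum_{u\in\mathrm{Des}(\sigma)}\mathrm{arm}(u)$ and $\mathrm{inv}(\sigma)=|\mathrm{Inv}(\sigma)|-\sum_{u\in\mathrm{Des}(\sigma)}\mathrm{leg}(u)$. Let $\mathrm{content}(\sigma)=(c_1,\dots,c_n)$ with $c_a=|\sigma^{-1}(a)|$. **The chain of roots.** Let $\Gamma(k)$ be the sequence of pairs $(i,l)$, $1\le i\le k<l\le n$, ordered by decreasing $i$ and, for equal $i$, by decreasing $l$; let $\Gamma'(k)$ be $\Gamma(k)$ with all pairs $(i,k+1)$ removed. Let $\Gamma=\Gamma_{\lambda_1}\Gamma_{\lambda_1-1}\cdots\Gamma_2=(\beta_1,\dots,\beta_m)$, where $\Gamma_j=\Gamma'(\lambda'_j)$ if $j$ is the smallest column index with column height $\lambda'_j$, and $\Gamma_j=\Gamma(\lambda'_j)$ otherwise. A pair $(i,k)$ stands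 for the root $\varepsilon_i-\varepsilon_k$ and for the transposition of $i$ and $k$ in $S_n$. Let $l_p=|\{p'\le p:\beta_{p'}=\beta_p\}|$. For $\alpha=\varepsilon_i-\varepsilon_k$ and $c\in\mathbb Z$ let $H_{\alpha,c}=\{v\in\mathbb{R}^n: v_i-v_k=c\}$ and $s_{\alpha,c}(v)=v-(v_i-v_k-c)\alpha$; put $\widehat r_p=s_{\beta_p,l_p}$. **Folding pairs.** A folding pair $(w,T)$ consists of $w\in S_n$ and a subsequence $T$ of $\Gamma$, given by a set of positions $J=\{j_1<\dots<j_s\}$; write $|T|=s$, let $T_j$ be the part of $T$ in $\Gamma_j$, and let $wT$ (and likewise $wT_{\lambda_1}\cdots T_{j+1}$) denote $w$ multiplied on the right by the transpositions in $T$, from left to right. Let $\mu(T)=\widehat r_{j_1}\cdots\widehat r_{j_s}(\lambda)\in\mathbb{Z}^n$, and let $S_n$ act on vectors by $w(\varepsilon_i)=\varepsilon_{w(i)}$. The filling $f(w,T)$ is defined by $f(w,T)(i,j)=\pi_j(i)$, where $\pi_j=wT_{\lambda_1}T_{\lambda_1-1}\cdots T_{j+1}$. Let $A_0=\{v: 0<v_i-v_k<1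 \text{ for all } i<k\}$ and $A_p=\widehat r_p(A_{p-1})$. For $p\in J$ put $g=w\,\widehat r_{j_1}\cdots\widehat r_{j_h}$, where $j_1<\dots<j_h$ are the elements of $J$ smaller than $p$; the position $p$ is a positive folding if the alcove $g(A_{p-1})$ lies on the positive side $\{v: v_a-v_b>c\}$ of the hyperplane $g(H_{\beta_p,l_p})=H_{\varepsilon_a-\varepsilon_b,\,c}$, $a<b$, and a negative folding otherwise. Let $T_j^+$ and $T_j^-$ be the parts of $T_j$ in the positive and negative folding positions. Let $\ell$ be the length function (number of inversions) on $S_n$. **Theorem.** For every nonattacking filling $\sigma:\lambda\to[n]$, the fibre $f^{-1}(\sigma)$ is nonempty, and $x^{w(\mu(T))}=x^{\mathrm{content}(\sigma)}$ for all $(w,T)\in f^{-1}(\sigma)$. Furthermore, $$\sum_{(w,T)\in f^{-1}(\sigma)} t^{\frac12(\ell(w)-\ell(wT)-|T|)}(1-t)^{|T|}\Bigg(\prod_{j,\,(i,k)\in T_j^+}\frac{1}{1-q^{\mathrm{arm}(i,j-1)}t^{k-i}}\Bigg)\Bigg(\prod_{j,\,(i,k)\in T_j^-}\frac{q^{\mathrm{arm}(i,j-1)}t^{k-i}}{1-q^{\mathrm{arm}(i,j-1)}t^{k-i}}\Bigg)$$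 $$=t^{\,n(\lambda)-\mathrm{inv}(\sigma)}\,q^{\mathrm{maj}(\sigma)}\prod_{u\in\mathrm{Diff}(\sigma)}\frac{1-t}{1-q^{\mathrm{arm}(u)}t^{\mathrm{leg}(u)+1}}.$$ -/

import Mathlib

namespace RamYip

/-! Positions `1, …, n` are modelled by `Fin n`, so row `i` of a diagram is the element of `Fin n`
with value `i - 1`. Columns are numbered by natural numbers starting from `1`. -/

/-- A partition `λ₁ ≥ … ≥ λₙ` given by its parts is a regular dominant weight of type `A_{n-1}`:
`λ₁ > λ₂ > … > λₙ = 0`. -/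
def IsRegular {n : ℕ} (lam : Fin n → ℕ) : Prop :=
  StrictAnti lam ∧ ∀ i : Fin n, i.val + 1 = n → lam i = 0

/-- The largest part `λ₁`, i.e. the number of columns. -/
def numCols {n : ℕ} (lam : Fin n → ℕ) : ℕ :=
  Finset.univ.sup lam

/-- The Young diagram of `λ`: the cells `(i, j)` with `1 ≤ j ≤ λᵢ`. -/
def diagram {n : ℕ} (lam : Fin n → ℕ) : Finset (Fin n × ℕ) :=
  (Finset.univ ×ˢ Finset.Icc 1 (numCols lam)).filter fun u => u.2 ≤ lam u.1

/-- The part `λ'ⱼ` of the conjugate partition, i.e. the height of column `j ≥ 1`. -/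
def conj {n : ℕ} (lam : Fin n → ℕ) (j : ℕ) : ℕ :=
  (Finset.univ.filter fun i : Fin n => j ≤ lam i).card

/-- `n(λ) = ∑ (i - 1) λᵢ`. -/
def nStat {n : ℕ} (lam : Fin n → ℕ) : ℕ :=
  ∑ i : Fin n, i.val * lam i

/-- The number of cells strictly to the left of `u` in its row (columns are numbered from right
to left, so these are the cells with a larger column number). -/
def arm {n : ℕ} (lam : Fin n → ℕ) (u : Fin n × ℕ) : ℕ :=
  ((diagram lam).filter fun v => v.1 = u.1 ∧ u.2 < v.2).card

/-- The number of cells strictly below `u` in its column. -/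
def leg {n : ℕ} (lam : Fin n → ℕ) (u : Fin n × ℕ) : ℕ :=
  ((diagram lam).filter fun v => v.2 = u.2 ∧ u.1 < v.1).card

/-! ### Fillings and their statistics -/

/-- A filling of the diagram of `λ` with entries in `{1, …, n}`. -/
abbrev Filling {n : ℕ} (lam : Fin n → ℕ) : Type :=
  {u : Fin n × ℕ // u ∈ diagram lam} → Fin n

/-- Two cells attack each other if they are distinct cells of one column, or lie in consecutive
columns with the cell in the left column strictly above the one in the right column. -/
def Attack {n : ℕ} (u v : Fin n × ℕ) : Prop :=
  (u.2 = v.2 ∧ u.1 ≠ v.1) ∨ (u.2 = v.2 + 1 ∧ u.1 < v.1) ∨ (v.2 = u.2 + 1 ∧ v.1 < u.1)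

/-- The reading order: columns from right to left, each column from top to bottom. -/
def Precedes {n : ℕ} (u v : Fin n × ℕ) : Prop :=
  u.2 < v.2 ∨ (u.2 = v.2 ∧ u.1 < v.1)

def Nonattacking {n : ℕ} {lam : Fin n → ℕ} (σ : Filling lam) : Prop :=
  ∀ u v, Attack u.1 v.1 → σ u ≠ σ v

open Classical in
/-- `Des(σ)`: the cells `(i, j)` with `(i, j + 1)` in the diagram and `σ(i, j) > σ(i, j + 1)`. -/
noncomputable def Des {n : ℕ} {lam : Fin n → ℕ} (σ : Filling lam) :
    Finset {u : Fin n × ℕ // u ∈ diagram lam} :=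
  Finset.univ.filter fun u => ∃ v, v.1 = (u.1.1, u.1.2 + 1) ∧ σ v < σ u

open Classical in
/-- `Diff(σ)`: the cells `(i, j)` with `(i, j + 1)` in the diagram and `σ(i, j) ≠ σ(i, j + 1)`. -/
noncomputable def Diff {n : ℕ} {lam : Fin n → ℕ} (σ : Filling lam) :
    Finset {u : Fin n × ℕ // u ∈ diagram lam} :=
  Finset.univ.filter fun u => ∃ v, v.1 = (u.1.1, u.1.2 + 1) ∧ σ u ≠ σ v

open Classical in
/-- The set of inversions of `σ`. -/
noncomputable def Inv {n : ℕ} {lam : Fin n → ℕ} (σ : Filling lam) :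
    Finset ({u : Fin n × ℕ // u ∈ diagram lam} × {u : Fin n × ℕ // u ∈ diagram lam}) :=
  Finset.univ.filter fun p =>
    Attack p.1.1 p.2.1 ∧ Precedes p.1.1 p.2.1 ∧ σ p.2 < σ p.1

noncomputable def maj {n : ℕ} {lam : Fin n → ℕ} (σ : Filling lam) : ℕ :=
  ∑ u ∈ Des σ, arm lam u.1

noncomputable def inv {n : ℕ} {lam : Fin n → ℕ} (σ : Filling lam) : ℤ :=
  ((Inv σ).card : ℤ) - ∑ u ∈ Des σ, (leg lam u.1 : ℤ)

/-- The content of a filling, as an exponent vector in `ℤⁿ`. -/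
def content {n : ℕ} {lam : Fin n → ℕ} (σ : Filling lam) : Fin n → ℤ :=
  fun a => ((Finset.univ.filter fun u => σ u = a).card : ℤ)

/-! ### The `λ`-chain -/

/-- An entry of the chain `Γ`: the positive root `ε_lo - ε_hi` together with the index `col` of the
segment `Γ_col` in which it occurs. -/
structure Entry (n : ℕ) where
  col : ℕ
  lo : Fin n
  hi : Fin n

/-- The rows `i = k, k - 1, …, 1` in this order, where row `i` consists of the pairs
`(i, n), (i, n - 1), …, (i, r + 1)` in this order. -/
def rootRows (n k r : ℕ) : List (Fin n × Fin n) :=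
  ((List.finRange n).reverse.filter fun i => i.val < k).flatMap fun i =>
    ((List.finRange n).reverse.filter fun h => r ≤ h.val).map fun h => (i, h)

/-- `Γ(k)`. -/
def gamma (n k : ℕ) : List (Fin n × Fin n) := rootRows n k k

/-- `Γ'(k)`, obtained from `Γ(k)` by removing the pair `(i, k + 1)` at the end of each row. -/
def gamma' (n k : ℕ) : List (Fin n × Fin n) := rootRows n k (k + 1)

/-- The segment `Γⱼ`: it is `Γ'(λ'ⱼ)` if `j` is the smallest column index with column height `λ'ⱼ`,
and `Γ(λ'ⱼ)` otherwise. -/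
def segment {n : ℕ} (lam : Fin n → ℕ) (j : ℕ) : List (Fin n × Fin n) :=
  if ∀ i < j, 1 ≤ i → conj lam i ≠ conj lam j then gamma' n (conj lam j)
  else gamma n (conj lam j)

/-- The `λ`-chain `Γ = Γ_{λ₁} ⋯ Γ₂`. -/
def chain {n : ℕ} (lam : Fin n → ℕ) : List (Entry n) :=
  (List.range' 2 (numCols lam - 1)).reverse.flatMap fun j =>
    (segment lam j).map fun β => ⟨j, β.1, β.2⟩

/-- The positions `1, …, m` in the `λ`-chain. -/
abbrev Pos {n : ℕ} (lam : Fin n → ℕ) : Type := Fin (chain lam).length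

/-- The entry `β_p` of `Γ`. -/
def entry {n : ℕ} (lam : Fin n → ℕ) (p : Pos lam) : Entry n := (chain lam).get p

/-- `l_p`, the number of positions `p' ≤ p` carrying the same root as position `p`. -/
def level {n : ℕ} (lam : Fin n → ℕ) (p : Pos lam) : ℕ :=
  (Finset.univ.filter fun p' : Pos lam => p' ≤ p ∧
    (entry lam p').lo = (entry lam p).lo ∧ (entry lam p').hi = (entry lam p).hi).card

/-- The reflection `r_p`, a transposition in `Sₙ`. -/
def refl {n : ℕ} (lam : Fin n → ℕ) (p : Pos lam) : Equiv.Perm (Fin n) :=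
  Equiv.swap (entry lam p).lo (entry lam p).hi

/-- The affine reflection `s_{α,l}`, `α = ε_a - ε_b`, on `Rⁿ`: `v ↦ v - (⟨v, α^∨⟩ - l) α`. -/
def affineRefl {n : ℕ} {R : Type*} [CommRing R] (a b : Fin n) (l : ℤ) (v : Fin n → R) :
    Fin n → R :=
  v - (v a - v b - (l : R)) • (Pi.single a 1 - Pi.single b 1)

/-- The product `r̂_{p₁} ⋯ r̂_{pₛ}` of the affine reflections `r̂_p = s_{β_p, l_p}`, applied to `v`. -/
def affineWord {n : ℕ} (lam : Fin n → ℕ) {R : Type*} [CommRing R] (L : List (Pos lam))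
    (v : Fin n → R) : Fin n → R :=
  L.foldr (fun p x => affineRefl (entry lam p).lo (entry lam p).hi (level lam p) x) v

/-- The action of `Sₙ` on vectors by permuting coordinates, `w(ε_i) = ε_{w(i)}`. -/
def permAct {n : ℕ} {R : Type*} (w : Equiv.Perm (Fin n)) (v : Fin n → R) : Fin n → R :=
  fun a => v (w⁻¹ a)

/-! ### Folding pairs -/

/-- The elements of `J`, in increasing order. -/
def sorted {n : ℕ} {lam : Fin n → ℕ} (J : Finset (Pos lam)) : List (Pos lam) :=
  (List.finRange (chain lam).length).filter fun p => p ∈ J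

/-- The Weyl group element `φ(J) = r_{j₁} ⋯ r_{jₛ}`. -/
def phi {n : ℕ} {lam : Fin n → ℕ} (J : Finset (Pos lam)) : Equiv.Perm (Fin n) :=
  ((sorted J).map (refl lam)).prod

/-- The weight `μ(J) = r̂_{j₁} ⋯ r̂_{jₛ}(λ)`. -/
def mu {n : ℕ} {lam : Fin n → ℕ} (J : Finset (Pos lam)) : Fin n → ℤ :=
  affineWord lam (sorted J) fun i => (lam i : ℤ)

/-- The permutation `π_j(w, T) = w T_{λ₁} T_{λ₁ - 1} ⋯ T_{j+1}`. -/
def piPerm {n : ℕ} {lam : Fin n → ℕ} (w : Equiv.Perm (Fin n)) (J : Finset (Pos lam)) (j : ℕ) :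
    Equiv.Perm (Fin n) :=
  w * phi (J.filter fun p => j < (entry lam p).col)

/-- The filling map `f`, `f(w, T)(i, j) = π_j(i)`. -/
def fillingMap {n : ℕ} (lam : Fin n → ℕ) (w : Equiv.Perm (Fin n)) (J : Finset (Pos lam)) :
    Filling lam :=
  fun u => piPerm w J u.1.2 u.1.1

/-- The length of a permutation: its number of inversions. -/
def permLength {n : ℕ} (w : Equiv.Perm (Fin n)) : ℕ :=
  (Finset.univ.filter fun p : Fin n × Fin n => p.1 < p.2 ∧ w p.2 < w p.1).card

/-! ### Positive and negative foldings

Subsets of `V = ℝⁿ / ℝ(1, …, 1)` are represented by their preimages in `ℝⁿ`. -/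

/-- The hyperplane `H_{α,c}` for `α = ε_a - ε_b`. -/
def hyperplane {n : ℕ} (a b : Fin n) (c : ℤ) : Set (Fin n → ℝ) :=
  {v | v a - v b = c}

/-- The fundamental alcove. -/
def fundamentalAlcove (n : ℕ) : Set (Fin n → ℝ) :=
  {v | ∀ a b : Fin n, a < b → 0 < v a - v b ∧ v a - v b < 1}

/-- The alcove `A_{p-1}` of the alcove path `Π`, i.e. the one from which the path crosses the `p`-th
wall. As `r̂_i` is the reflection in the common wall of `A_{i-1}` and `A_i`, it is the image of the
fundamental alcove under `r̂_{p-1} ⋯ r̂_1`. -/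
def alcoveBefore {n : ℕ} (lam : Fin n → ℕ) (p : Pos lam) : Set (Fin n → ℝ) :=
  affineWord lam (sorted (Finset.univ.filter fun p' => p' < p)).reverse '' fundamentalAlcove n

/-- The affine map `w r̂_{j₁} ⋯ r̂_{jᵢ}`, where `j₁ < ⋯ < jᵢ` are the elements of `J` before `p`. The
foldings at these positions carry the alcove `w(A_{p-1})` and the `p`-th wall of `w(Π)` to the
corresponding alcove and wall of the alcove walk encoded by `(w, J)`; foldings at positions `≥ p`
leave both unchanged. -/
def foldedMap {n : ℕ} {lam : Fin n → ℕ} (w : Equiv.Perm (Fin n)) (J : Finset (Pos lam))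
    (p : Pos lam) (v : Fin n → ℝ) : Fin n → ℝ :=
  permAct w (affineWord lam (sorted (J.filter fun p' => p' < p)) v)

/-- `p` is a positive folding position of the alcove walk of `(w, J)` (for `p ∈ J`): the alcove of
the walk at position `p` lies on the positive side `⟨v, α^∨⟩ > c` of the hyperplane `H_{α,c}`,
`α` a positive root, which contains the `p`-th face of the walk. -/
def IsPositiveFolding {n : ℕ} {lam : Fin n → ℕ} (w : Equiv.Perm (Fin n)) (J : Finset (Pos lam))
    (p : Pos lam) : Prop :=
  ∃ (a b : Fin n) (c : ℤ), a < b ∧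
    foldedMap w J p '' hyperplane (entry lam p).lo (entry lam p).hi (level lam p)
      = hyperplane a b c ∧
    foldedMap w J p '' alcoveBefore lam p ⊆ {v | (c : ℝ) < v a - v b}

open Classical in
/-- `J⁺`, the set of positive foldings. -/
noncomputable def Jpos {n : ℕ} {lam : Fin n → ℕ} (w : Equiv.Perm (Fin n)) (J : Finset (Pos lam)) :
    Finset (Pos lam) :=
  J.filter fun p => IsPositiveFolding w J p

open Classical in
/-- `J⁻`, the set of negative foldings. -/
noncomputable def Jneg {n : ℕ} {lam : Fin n → ℕ} (w : Equiv.Perm (Fin n)) (J : Finset (Pos lam)) :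
    Finset (Pos lam) :=
  J.filter fun p => ¬ IsPositiveFolding w J p

/-- The factor `q^{arm(i, j-1)} t^{k-i}` attached to a pair `(i, k)` in the segment `Γⱼ`. -/
def qtFactor {n : ℕ} (lam : Fin n → ℕ) {K : Type*} [Field K] (q t : K) (p : Pos lam) : K :=
  q ^ arm lam ((entry lam p).lo, (entry lam p).col - 1) *
    t ^ ((entry lam p).hi.val - (entry lam p).lo.val)

/-- The coefficient of the folding pair `(w, T)` in the type `A` Ram–Yip formula. The exponent
`(ℓ(w) - ℓ(wT) - |T|) / 2` is an integer, since every factor of `T` is a transposition and so changes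
the parity of the length. -/
noncomputable def weight {n : ℕ} {lam : Fin n → ℕ} {K : Type*} [Field K] (q t : K)
    (w : Equiv.Perm (Fin n)) (J : Finset (Pos lam)) : K :=
  t ^ (((permLength w : ℤ) - (permLength (w * phi J) : ℤ) - (J.card : ℤ)) / 2) *
    (1 - t) ^ J.card *
    (∏ p ∈ Jpos w J, 1 / (1 - qtFactor lam q t p)) *
    (∏ p ∈ Jneg w J, qtFactor lam q t p / (1 - qtFactor lam q t p))

/-- The fibre `f⁻¹(σ)` of the filling map, a set of folding pairs. -/
def fibre {n : ℕ} {lam : Fin n → ℕ} (σ : Filling lam) :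
    Finset (Equiv.Perm (Fin n) × Finset (Pos lam)) :=
  Finset.univ.filter fun P => fillingMap lam P.1 P.2 = σ

end RamYip

namespace RamYip

variable {n : ℕ} {lam : Fin n → ℕ}

/-! ### Columns, arms and legs -/

/-! The weight of a folding pair is multiplicative along its walk. A folding at `(i, l)` met at the
current permutation `u` is positive exactly when `u l < u i` (`isPositiveFolding_iff`). It changes
the exponent of `t` by an integer that counts the values between `u i` and `u l` at positions
between `i` and `l` (`permLength_step`). Hence the weight is a product of local factors
(`weight_eq_walkCoeff`).

The sum is organised by the end `v = wT` of the walk instead of its start. Column 1 of the filling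
is `v` on all rows except possibly the last, so `σ` determines `v` (`existsUnique_colMatch_one`).
Reading the chain backwards from `v` turns the sum into an iterated transfer operator, one segment
for each pair of adjacent columns (`subSum_walkCoeff`, `colSum_eq`). Row `i` of a segment alters
only position `i` and positions below the right-hand column. All ways of turning the entry `a` in
row `i` into its left neighbour `b` add up to one closed factor `rowCoeff` (`foldl_row`), by a
telescoping that rests on two rational identities. The nonattacking condition forces `b` to be at
position `i` or below the right-hand column (`foldl_rows`). The resulting factor depends only on
entries inside the diagram, so the fibre sum factors over the cells that have a left neighbour
(`colSum_eq_prod`).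

It remains to compare powers of `t`. For a triple of entries `a = σ(i,j)`, `b = σ(i,j+1)`, `c =
σ(m,j)` with `i < m`, nonattacking gives `c ≠ a, b`, hence `1 = [c < a] + [b < c] + [a < c < b] - [b
< c < a]`. Summing over the `n(λ)` triples yields `nStat_eq`, which matches the product with `n(λ) -
inv` and `maj`.

For the content, `λ` is the sum of the indicator vectors of its columns, and the affine reflection
of an entry in segment `c` applies the transposition to the columns `j < c` only (`affineWord_lam`).
Nonemptiness of the fibre follows from the summation formula itself: the fibre does not involve `q`
and `t`, and the right side is nonzero for suitable rational values. -/

theorem le_numCols (lam : Fin n → ℕ) (i : Fin n) : lam i ≤ numCols lam :=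
  Finset.le_sup (f := lam) (Finset.mem_univ i)

theorem mem_diagram {u : Fin n × ℕ} : u ∈ diagram lam ↔ 1 ≤ u.2 ∧ u.2 ≤ lam u.1 := by
  have := le_numCols lam u.1
  simp only [diagram, Finset.mem_filter, Finset.mem_product, Finset.mem_univ, Finset.mem_Icc]
  constructor <;> intro h <;> refine ⟨?_, ?_⟩ <;> first | omega | (refine ⟨trivial, ?_⟩; omega)

/-- As `lam` decreases, the rows meeting column `j` form an initial segment, so their number bounds
their indices; the strict inequality comes from rows starting at `0`. -/
theorem lt_conj_iff (h : StrictAnti lam) {i : Fin n} {j : ℕ} :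
    i.val < conj lam j ↔ j ≤ lam i := by
  unfold conj
  constructor
  · intro hi
    by_contra hj
    have hsub : (Finset.univ.filter fun m : Fin n => j ≤ lam m) ⊆ Finset.Iio i := by
      intro m hm
      simp only [Finset.mem_filter, Finset.mem_univ, true_and] at hm
      rw [Finset.mem_Iio]
      by_contra hmi
      have := h.antitone (not_lt.mp hmi)
      omega
    have := Finset.card_le_card hsub
    rw [Fin.card_Iio] at this
    omega
  · intro hj
    have hsub : Finset.Iic i ⊆ (Finset.univ.filter fun m : Fin n => j ≤ lam m) := by
      intro m hm
      rw [Finset.mem_Iic] at hm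
      simp only [Finset.mem_filter, Finset.mem_univ, true_and]
      exact hj.trans (h.antitone hm)
    have := Finset.card_le_card hsub
    rw [Fin.card_Iic] at this
    omega

theorem conj_le_iff (h : StrictAnti lam) {i : Fin n} {j : ℕ} :
    conj lam j ≤ i.val ↔ lam i < j := by
  rw [← not_lt, lt_conj_iff h, not_le]

theorem conj_le (lam : Fin n → ℕ) (j : ℕ) : conj lam j ≤ n := by
  unfold conj
  exact (Finset.card_le_univ _).trans (by simp)

theorem conj_anti (lam : Fin n → ℕ) : Antitone (conj lam) := by
  intro j j' hj
  unfold conj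
  refine Finset.card_le_card fun m hm => ?_
  simp only [Finset.mem_filter, Finset.mem_univ, true_and] at hm ⊢
  omega

/-- Two rows of equal length would be needed for a larger drop. This is where regularity makes the
two kinds of segments uniform. -/
theorem conj_le_conj_succ (h : StrictAnti lam) (j : ℕ) : conj lam j ≤ conj lam (j + 1) + 1 := by
  by_contra hlt
  have hn := conj_le lam j
  have h1 := (lt_conj_iff h (i := ⟨conj lam (j + 1), by omega⟩) (j := j)).1 (by simp; omega)
  have h2 := (lt_conj_iff h (i := ⟨conj lam (j + 1) + 1, by omega⟩) (j := j)).1 (by simp; omega)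
  have h3 : ¬ (j + 1 ≤ lam ⟨conj lam (j + 1), by omega⟩) := by
    rw [← lt_conj_iff h]; simp
  have h4 := @h ⟨conj lam (j + 1), by omega⟩ ⟨conj lam (j + 1) + 1, by omega⟩ (by simp)
  omega

theorem pos_of_succ_lt (h : StrictAnti lam) {i : Fin n} (hi : i.val + 1 < n) : 1 ≤ lam i := by
  have := @h i ⟨i.val + 1, hi⟩ (by simp [Fin.lt_def])
  omega

theorem arm_eq (lam : Fin n → ℕ) (i : Fin n) (j : ℕ) : arm lam (i, j) = lam i - j := by
  have : ((diagram lam).filter fun v => v.1 = i ∧ j < v.2) =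
      (Finset.Ioc j (lam i)).map ⟨fun k => (i, k), fun a b hab => by simpa using hab⟩ := by
    ext ⟨a, b⟩
    simp only [Finset.mem_filter, mem_diagram, Finset.mem_map, Finset.mem_Ioc]
    constructor
    · rintro ⟨h1, rfl, h2⟩
      exact ⟨b, ⟨h2, h1.2⟩, rfl⟩
    · rintro ⟨k, h1, ⟨⟩⟩
      exact ⟨⟨by omega, h1.2⟩, rfl, h1.1⟩
  rw [arm, this, Finset.card_map, Nat.card_Ioc]

theorem leg_eq (h : StrictAnti lam) (i : Fin n) {j : ℕ} (hj : 1 ≤ j) :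
    leg lam (i, j) = conj lam j - (i.val + 1) := by
  have h1 : ((diagram lam).filter fun v => v.2 = j ∧ i < v.1) =
      (Finset.univ.filter fun m : Fin n => j ≤ lam m ∧ i < m).map
        ⟨fun k => (k, j), fun a b hab => by simpa using hab⟩ := by
    ext ⟨a, b⟩
    simp only [Finset.mem_filter, mem_diagram, Finset.mem_map, Finset.mem_univ, true_and]
    constructor
    · rintro ⟨h1, rfl, h2⟩
      exact ⟨a, ⟨h1.2, h2⟩, rfl⟩
    · rintro ⟨k, h1, ⟨⟩⟩
      exact ⟨⟨hj, h1.1⟩, rfl, h1.2⟩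
  rw [leg, h1, Finset.card_map]
  have h2 : (Finset.univ.filter fun m : Fin n => j ≤ lam m ∧ i < m).card =
      (Finset.Ico (i.val + 1) (conj lam j)).card := by
    refine Finset.card_bij (fun m _ => m.val) ?_ ?_ ?_
    · intro m hm
      simp only [Finset.mem_filter, Finset.mem_univ, true_and, ← lt_conj_iff h, Fin.lt_def] at hm
      rw [Finset.mem_Ico]; omega
    · intro a _ b _ hab
      exact Fin.ext hab
    · intro m hm
      rw [Finset.mem_Ico] at hm
      have := conj_le lam j
      refine ⟨⟨m, by omega⟩, ?_, rfl⟩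
      simp only [Finset.mem_filter, Finset.mem_univ, true_and, ← lt_conj_iff h, Fin.lt_def]
      omega
  rw [h2, Nat.card_Ico]

/-! ### The chain -/

/-- Column heights drop by at most one. If `j` is the first column of its height, the previous
column is higher by exactly one, which accounts for the removed roots; otherwise both heights agree.
Thus `hi` always ranges over the rows below column `j - 1`. -/
theorem segment_eq (h : StrictAnti lam) {j : ℕ} (hj : 2 ≤ j) :
    segment lam j = rootRows n (conj lam j) (conj lam (j - 1)) := by
  have h1 := conj_le_conj_succ h (j - 1)
  rw [Nat.sub_add_cancel (by omega : 1 ≤ j)] at h1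
  have h2 := conj_anti lam (by omega : j - 1 ≤ j)
  unfold segment
  split_ifs with hfirst
  · have := hfirst (j - 1) (by omega) (by omega)
    rw [gamma', show conj lam j + 1 = conj lam (j - 1) by omega]
  · push Not at hfirst
    obtain ⟨i, hij, -, hi⟩ := hfirst
    have := conj_anti lam (by omega : i ≤ j - 1)
    rw [gamma]
    congr 1
    omega

theorem mem_rootRows {k r : ℕ} {β : Fin n × Fin n} :
    β ∈ rootRows n k r ↔ β.1.val < k ∧ r ≤ β.2.val := by
  obtain ⟨a, b⟩ := β
  simp [rootRows]

/-- A root `ε_a - ε_b` occurs at most once per segment, and the segments containing it form the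
interval from `lam b + 2` to `lam a`. All later counting of roots uses this description. -/
theorem mem_chain (h : StrictAnti lam) {e : Entry n} :
    e ∈ chain lam ↔ 2 ≤ e.col ∧ e.col ≤ lam e.lo ∧ lam e.hi + 2 ≤ e.col := by
  obtain ⟨j, i, l⟩ := e
  have hN := le_numCols lam i
  simp only [chain, List.mem_flatMap, List.mem_reverse, List.mem_range'_1, List.mem_map]
  constructor
  · rintro ⟨j', hj', β, hβ, he⟩
    rw [segment_eq h hj'.1, mem_rootRows, lt_conj_iff h, conj_le_iff h] at hβ
    obtain ⟨rfl, rfl, rfl⟩ := Entry.mk.inj he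
    omega
  · intro hj
    refine ⟨j, by omega, (i, l), ?_, rfl⟩
    rw [segment_eq h hj.1, mem_rootRows, lt_conj_iff h, conj_le_iff h]
    simp only at hj ⊢
    omega

/-- The strict total order on entries in which the chain is sorted. -/
def EntryBefore (e e' : Entry n) : Prop :=
  e'.col < e.col ∨ (e'.col = e.col ∧ (e'.lo < e.lo ∨ (e'.lo = e.lo ∧ e'.hi < e.hi)))

theorem EntryBefore.irrefl (e : Entry n) : ¬ EntryBefore e e := by simp [EntryBefore]

theorem EntryBefore.asymm {e e' : Entry n} (h : EntryBefore e e') : ¬ EntryBefore e' e := by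
  unfold EntryBefore at *
  omega

theorem pairwise_finRange_reverse (n : ℕ) :
    ((List.finRange n).reverse).Pairwise (fun a b => b < a) := by
  rw [List.pairwise_reverse]
  exact List.pairwise_lt_finRange n

theorem pairwise_chain (lam : Fin n → ℕ) : (chain lam).Pairwise EntryBefore := by
  have hrows : ∀ k r, (rootRows n k r).Pairwise
      (fun a b => b.1 < a.1 ∨ (b.1 = a.1 ∧ b.2 < a.2)) := by
    intro k r
    rw [rootRows, List.pairwise_flatMap]
    constructor
    · intro i _
      rw [List.pairwise_map]
      refine ((pairwise_finRange_reverse n).filter _).imp fun hab => ?_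
      exact Or.inr ⟨rfl, hab⟩
    · refine ((pairwise_finRange_reverse n).filter _).imp fun hab => ?_
      intro x hx y hy
      simp only [List.mem_map] at hx hy
      obtain ⟨_, _, rfl⟩ := hx
      obtain ⟨_, _, rfl⟩ := hy
      exact Or.inl hab
  have hseg : ∀ j, (segment lam j).Pairwise
      (fun a b => b.1 < a.1 ∨ (b.1 = a.1 ∧ b.2 < a.2)) := by
    intro j
    unfold segment gamma gamma'
    split_ifs <;> exact hrows _ _
  rw [chain, List.pairwise_flatMap]
  constructor
  · intro j _
    rw [List.pairwise_map]
    exact (hseg j).imp fun hab => Or.inr ⟨rfl, hab⟩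
  · rw [List.pairwise_reverse]
    refine (List.pairwise_lt_range' (s := 2) (n := numCols lam - 1)).imp fun hab => ?_
    intro x hx y hy
    simp only [List.mem_map] at hx hy
    obtain ⟨_, _, rfl⟩ := hx
    obtain ⟨_, _, rfl⟩ := hy
    exact Or.inl hab

theorem entry_before_iff (lam : Fin n → ℕ) {p p' : Pos lam} :
    EntryBefore (entry lam p) (entry lam p') ↔ p < p' := by
  have h := List.pairwise_iff_get.mp (pairwise_chain lam)
  constructor
  · intro hb
    by_contra hlt
    rcases (not_lt.mp hlt).lt_or_eq with hlt | heq
    · exact (h _ _ hlt).asymm hb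
    · subst heq
      exact EntryBefore.irrefl _ hb
  · exact h p p'

theorem entry_injective (lam : Fin n → ℕ) : Function.Injective (entry lam) := by
  intro p p' hpp
  rcases lt_trichotomy p p' with h | h | h
  · rw [← entry_before_iff, hpp] at h
    exact absurd h (EntryBefore.irrefl _)
  · exact h
  · rw [← entry_before_iff, hpp] at h
    exact absurd h (EntryBefore.irrefl _)

theorem entry_mem (lam : Fin n → ℕ) (p : Pos lam) : entry lam p ∈ chain lam := List.get_mem _ _

theorem exists_entry {e : Entry n} (he : e ∈ chain lam) : ∃ p, entry lam p = e :=
  List.mem_iff_get.mp he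

theorem lo_lt_hi (h : StrictAnti lam) {e : Entry n} (he : e ∈ chain lam) : e.lo < e.hi := by
  rw [mem_chain h] at he
  by_contra hlt
  have := h.antitone (not_lt.mp hlt)
  omega

/-- The number of the first `k` positions of the chain that carry the root `ε_a - ε_b`. -/
def rootCount (lam : Fin n → ℕ) (k : ℕ) (a b : Fin n) : ℕ :=
  (Finset.univ.filter fun p : Pos lam =>
    p.val < k ∧ (entry lam p).lo = a ∧ (entry lam p).hi = b).card

-- An occurrence of a fixed root is determined by its segment, so occurrences before `p` can be
-- counted by column index.
open Classical in
theorem rootCount_eq (h : StrictAnti lam) (p : Pos lam) {a b : Fin n} :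
    rootCount lam p.val a b = ((Finset.Icc (lam b + 2) (lam a)).filter fun j =>
      EntryBefore ⟨j, a, b⟩ (entry lam p)).card := by
  refine Finset.card_bij (fun p' _ => (entry lam p').col) ?_ ?_ ?_
  · intro p' hp'
    simp only [Finset.mem_filter, Finset.mem_univ, true_and] at hp'
    obtain ⟨hlt, rfl, rfl⟩ := hp'
    have := (mem_chain h).1 (entry_mem lam p')
    simp only [Finset.mem_filter, Finset.mem_Icc]
    exact ⟨⟨this.2.2, this.2.1⟩, (entry_before_iff lam).2 hlt⟩
  · intro p₁ h₁ p₂ h₂ hcol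
    simp only [Finset.mem_filter, Finset.mem_univ, true_and] at h₁ h₂
    apply entry_injective lam
    cases h1 : entry lam p₁
    cases h2 : entry lam p₂
    simp_all
  · intro j hj
    simp only [Finset.mem_filter, Finset.mem_Icc] at hj
    obtain ⟨p', hp'⟩ := exists_entry (lam := lam) (e := ⟨j, a, b⟩)
      ((mem_chain h).2 ⟨by simp only; omega, hj.1.2, hj.1.1⟩)
    refine ⟨p', ?_, by rw [hp']⟩
    simp only [Finset.mem_filter, Finset.mem_univ, true_and]
    refine ⟨?_, by rw [hp'], by rw [hp']⟩
    rw [← Fin.lt_def, ← entry_before_iff lam, hp']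
    exact hj.2

/-- The hypothesis says that, within one segment, `(a, b)` comes before the root at `p`; the segment
of `p` is therefore counted as well, provided that it contains `(a, b)`. In
`rootCount_of_not_before` it is left out. -/
theorem rootCount_of_before (h : StrictAnti lam) (p : Pos lam) {a b : Fin n}
    (hab : (entry lam p).lo < a ∨ ((entry lam p).lo = a ∧ (entry lam p).hi < b)) :
    rootCount lam p.val a b = lam a + 1 - max (lam b + 2) (entry lam p).col := by
  classical
  rw [rootCount_eq h, ← Nat.card_Icc]
  congr 1
  ext j
  simp only [Finset.mem_filter, Finset.mem_Icc, EntryBefore, hab, and_true]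
  omega

theorem rootCount_of_not_before (h : StrictAnti lam) (p : Pos lam) {a b : Fin n}
    (hab : ¬ ((entry lam p).lo < a ∨ ((entry lam p).lo = a ∧ (entry lam p).hi < b))) :
    rootCount lam p.val a b = lam a + 1 - max (lam b + 2) ((entry lam p).col + 1) := by
  classical
  rw [rootCount_eq h, ← Nat.card_Icc]
  congr 1
  ext j
  simp only [Finset.mem_filter, Finset.mem_Icc, EntryBefore, hab, and_false, or_false]
  omega

theorem rootCount_succ (lam : Fin n → ℕ) (p : Pos lam) (a b : Fin n) :
    rootCount lam (p.val + 1) a b = rootCount lam p.val a b +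
      if (entry lam p).lo = a ∧ (entry lam p).hi = b then 1 else 0 := by
  classical
  have : (Finset.univ.filter fun p' : Pos lam =>
      p'.val < p.val + 1 ∧ (entry lam p').lo = a ∧ (entry lam p').hi = b) =
      (Finset.univ.filter fun p' : Pos lam =>
        p'.val < p.val ∧ (entry lam p').lo = a ∧ (entry lam p').hi = b) ∪
      (if (entry lam p).lo = a ∧ (entry lam p).hi = b then {p} else ∅) := by
    ext p'
    split_ifs with hc
    · simp only [Finset.mem_filter, Finset.mem_univ, true_and, Finset.mem_union,
        Finset.mem_singleton]
      rcases eq_or_ne p' p with rfl | hne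
      · simp [hc]
      · have : p'.val ≠ p.val := fun h => hne (Fin.ext h)
        simp only [hne, or_false, and_congr_left_iff]
        omega
    · simp only [Finset.mem_filter, Finset.mem_univ, true_and, Finset.union_empty]
      rcases eq_or_ne p' p with rfl | hne
      · simp [hc]
      · have : p'.val ≠ p.val := fun h => hne (Fin.ext h)
        simp only [and_congr_left_iff]
        omega
  unfold rootCount
  rw [this, Finset.card_union_of_disjoint]
  · split_ifs <;> simp
  · split_ifs <;> simp

theorem rootCount_self (h : StrictAnti lam) (p : Pos lam) :
    rootCount lam p.val (entry lam p).lo (entry lam p).hi =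
      lam (entry lam p).lo - (entry lam p).col := by
  have := (mem_chain h).1 (entry_mem lam p)
  rw [rootCount_of_not_before h p (by simp)]
  omega

theorem level_eq_rootCount (lam : Fin n → ℕ) (p : Pos lam) :
    level lam p = rootCount lam p.val (entry lam p).lo (entry lam p).hi + 1 := by
  have := rootCount_succ lam p (entry lam p).lo (entry lam p).hi
  rw [if_pos ⟨rfl, rfl⟩] at this
  rw [← this, level, rootCount]
  congr 1
  ext p'
  simp only [Fin.le_def, Nat.lt_succ_iff]

/-- This is the number of columns with index at least `col` that meet row `lo`; `affineWord_lam`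
depends on this reading. -/
theorem level_eq (h : StrictAnti lam) (p : Pos lam) :
    level lam p = lam (entry lam p).lo - (entry lam p).col + 1 := by
  rw [level_eq_rootCount, rootCount_self h]

/-! ### Affine reflections and the alcove path -/

theorem affineRefl_apply {R : Type*} [CommRing R] {a b : Fin n} (hab : a ≠ b) (l : ℤ)
    (v : Fin n → R) (x : Fin n) :
    affineRefl a b l v x = v (Equiv.swap a b x) +
      (l : R) * ((if x = a then 1 else 0) - (if x = b then 1 else 0)) := by
  simp only [affineRefl, Pi.sub_apply, Pi.smul_apply, smul_eq_mul, Pi.single_apply]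
  rcases eq_or_ne x a with rfl | hxa
  · simp [hab]
    ring
  · rcases eq_or_ne x b with rfl | hxb
    · simp [hab.symm]
      ring
    · simp [hxa, hxb, Equiv.swap_apply_of_ne_of_ne hxa hxb]

theorem entry_lo_lt_hi (h : StrictAnti lam) (p : Pos lam) :
    (entry lam p).lo < (entry lam p).hi :=
  lo_lt_hi h (entry_mem lam p)

/-- Separates the linear part, a permutation of coordinates, from an integral translation. Only the
linear part decides the sign of a folding. -/
theorem exists_affineWord_apply (h : StrictAnti lam) (L : List (Pos lam)) :
    ∃ κ : Fin n → ℤ, ∀ (v : Fin n → ℝ) (x : Fin n),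
      affineWord lam L v x = v ((L.map (refl lam)).prod⁻¹ x) + κ x := by
  induction L with
  | nil => exact ⟨0, by simp [affineWord]⟩
  | cons p L ih =>
    obtain ⟨κ, hκ⟩ := ih
    refine ⟨fun x => κ (refl lam p x) + (level lam p : ℤ) *
      ((if x = (entry lam p).lo then 1 else 0) - (if x = (entry lam p).hi then 1 else 0)),
      fun v x => ?_⟩
    have : affineWord lam (p :: L) v = affineRefl (entry lam p).lo (entry lam p).hi
      (level lam p) (affineWord lam L v) := rfl
    rw [this, affineRefl_apply (entry_lo_lt_hi h p).ne, hκ]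
    simp only [List.map_cons, List.prod_cons, mul_inv_rev, Equiv.Perm.mul_apply, refl,
      Equiv.swap_inv]
    push_cast
    ring

theorem filter_lt_succ (N : ℕ) (k : Fin N) :
    (List.finRange N).filter (fun p => p.val < k.val + 1) =
      (List.finRange N).filter (fun p => p.val < k.val) ++ [k] := by
  have hs := List.pairwise_lt_finRange N
  refine (hs.filter _).eq_of_mem_iff (r := (· < ·)) ?_ ?_
  · rw [List.pairwise_append]
    refine ⟨hs.filter _, by simp, ?_⟩
    intro a ha b hb
    simp at ha hb
    subst hb
    exact ha
  · intro a
    simp only [List.mem_filter, List.mem_finRange, true_and, decide_eq_true_eq, List.mem_append,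
      List.mem_singleton, Fin.ext_iff]
    omega

/-- The effect of a reflection in a wall of an alcove on the strips containing the alcove. -/
theorem strip_affineRefl {i l : Fin n} (hil : i < l) (c : Fin n → Fin n → ℕ) (y : Fin n → ℝ)
    (hy : ∀ a b, a < b → (c a b : ℝ) < y a - y b ∧ y a - y b < c a b + 1)
    (habove : ∀ m, l < m → c i m = c i l + c l m + 1)
    (hbetween : ∀ m, i < m → m < l → c i m + c m l = c i l)
    (hbelow : ∀ m, m < i → c m l = c m i + c i l + 1) (a b : Fin n) (hab : a < b) :
    let x := affineRefl i l ((c i l + 1 : ℕ) : ℤ) y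
    let d := c a b + if i = a ∧ l = b then 1 else 0
    (d : ℝ) < x a - x b ∧ x a - x b < d + 1 := by
  intro x d
  have hself := hy i l hil
  simp only [x, d, affineRefl_apply hil.ne]
  -- Each coordinate difference after the reflection is a difference of `y` for another root, up to
  -- a shift by the level; the matching additivity hypothesis converts the strip of that root into
  -- the required one.
  rcases eq_or_ne a i with rfl | hai
  · rcases eq_or_ne b l with rfl | hbl
    · simp [hil.ne, hil.ne']
      constructor <;> linarith
    · have hb := hab.ne'
      rw [Equiv.swap_apply_left, Equiv.swap_apply_of_ne_of_ne hb hbl]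
      simp only [hil.ne, hb, hbl, hbl.symm, and_false, if_false, if_true]
      rcases lt_or_gt_of_ne hbl with hlt | hlt
      · have h1 : (c a b : ℝ) + c b l = c a l := by exact_mod_cast hbetween b hab hlt
        have h2 := hy b l hlt
        push_cast
        constructor <;> linarith
      · have h1 : (c a b : ℝ) = c a l + c l b + 1 := by exact_mod_cast habove b hlt
        have h2 := hy l b hlt
        push_cast
        constructor <;> linarith
  · rcases eq_or_ne a l with rfl | hal
    · have hbi : b ≠ i := (hil.trans hab).ne'
      rw [Equiv.swap_apply_right, Equiv.swap_apply_of_ne_of_ne hbi hab.ne']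
      simp only [hai, hai.symm, hbi, hab.ne', false_and, if_false, if_true]
      have h1 : (c i b : ℝ) = c i a + c a b + 1 := by exact_mod_cast habove b hab
      have h2 := hy i b (hil.trans hab)
      push_cast
      constructor <;> linarith
    · rw [Equiv.swap_apply_of_ne_of_ne hai hal]
      rcases eq_or_ne b i with rfl | hbi
      · rw [Equiv.swap_apply_left]
        simp only [hai, hai.symm, hal, hil.ne, false_and, if_false, if_true]
        have h1 : (c a l : ℝ) = c a b + c b l + 1 := by exact_mod_cast hbelow a hab
        have h2 := hy a l (hab.trans hil)
        push_cast
        constructor <;> linarith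
      · rcases eq_or_ne b l with rfl | hbl
        · rw [Equiv.swap_apply_right]
          simp only [hai, hai.symm, hal, hil.ne', false_and, if_false, if_true]
          rcases lt_or_gt_of_ne hai with hlt | hlt
          · have h1 : (c a b : ℝ) = c a i + c i b + 1 := by exact_mod_cast hbelow a hlt
            have h2 := hy a i hlt
            push_cast
            constructor <;> linarith
          · have h1 : (c i a : ℝ) + c a b = c i b := by exact_mod_cast hbetween a hlt hab
            have h2 := hy i a hlt
            push_cast
            constructor <;> linarith
        · rw [Equiv.swap_apply_of_ne_of_ne hbi hbl]
          simp only [hai, hai.symm, hal, hbi, hbl, false_and, if_false]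
          have h2 := hy a b hab
          push_cast
          constructor <;> linarith

theorem rootCount_zero (lam : Fin n → ℕ) (a b : Fin n) : rootCount lam 0 a b = 0 := by
  simp [rootCount]

/-- Every point of the alcove reached after `k` steps lies strictly between the hyperplanes
`H_{α,c}` and `H_{α,c+1}`, where `c` counts the occurrences of `α` among the first `k` roots. -/
theorem alcove_bounds (h : StrictAnti lam) (k : ℕ) (hk : k ≤ (chain lam).length)
    (v : Fin n → ℝ) (hv : v ∈ fundamentalAlcove n) (a b : Fin n) (hab : a < b) :
    let x := affineWord lam ((List.finRange (chain lam).length).filter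
      (fun p => p.val < k)).reverse v
    (rootCount lam k a b : ℝ) < x a - x b ∧ x a - x b < rootCount lam k a b + 1 := by
  induction k generalizing a b with
  | zero =>
    have := hv a b hab
    simpa [rootCount_zero, affineWord] using this
  | succ k ih =>
    intro x
    set p : Pos lam := ⟨k, by omega⟩ with hp
    have hsplit := filter_lt_succ _ p
    set y := affineWord lam ((List.finRange (chain lam).length).filter
      (fun p => p.val < k)).reverse v with hy
    have hx : x = affineRefl (entry lam p).lo (entry lam p).hi (level lam p) y := by
      simp only [x, hy]
      rw [show k + 1 = p.val + 1 from rfl, hsplit, List.reverse_append]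
      rfl
    replace ih := fun a b hab => ih (by omega) a b hab
    simp only at ih
    have hmem := (mem_chain h).1 (entry_mem lam p)
    have hil := entry_lo_lt_hi h p
    have hself : rootCount lam k (entry lam p).lo (entry lam p).hi = _ := rootCount_self h p
    rw [show k + 1 = p.val + 1 from rfl, rootCount_succ, hx, level_eq_rootCount]
    -- The three compatibility conditions reflect the order of the chain: in a segment, `(l, m)` and
    -- `(i, m)` with `m > l` precede `(i, l)`, while `(i, m)` with `m < l` and roots of smaller rows
    -- come after it.
    refine strip_affineRefl hil (rootCount lam k) y ih ?_ ?_ ?_ a b hab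
    · intro m hm
      have h1 := rootCount_of_before h p (a := (entry lam p).lo) (b := m) (Or.inr ⟨rfl, hm⟩)
      have h2 := rootCount_of_before h p (a := (entry lam p).hi) (b := m) (Or.inl hil)
      have h3 := h hm
      simp only [hp] at h1 h2 hself hmem h3 ⊢
      omega
    · intro m hm hm'
      have h1 := rootCount_of_not_before h p (a := (entry lam p).lo) (b := m)
        (by simp [hm'.le])
      have h2 := rootCount_of_before h p (a := m) (b := (entry lam p).hi) (Or.inl hm)
      have h3 := h hm
      have h4 := h hm'
      simp only [hp] at h1 h2 hself hmem h3 h4 ⊢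
      omega
    · intro m hm
      have h1 := rootCount_of_not_before h p (a := m) (b := (entry lam p).hi)
        (by simp [hm.le])
      have h2 := rootCount_of_not_before h p (a := m) (b := (entry lam p).lo)
        (by simp [hm.le, hm.ne'])
      have h3 := h hm
      simp only [hp] at h1 h2 hself hmem h3 ⊢
      omega

theorem exists_mem_fundamentalAlcove (n : ℕ) : ∃ v, v ∈ fundamentalAlcove n := by
  -- Neighbouring coordinates differ by `1 / (n + 1)`, so no two coordinates differ by as much as
  -- `1`.
  refine ⟨fun i => -(i.val : ℝ) / (n + 1), fun a b hab => ?_⟩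
  have h0 : (0 : ℝ) < n + 1 := by positivity
  have h1 : (a.val : ℝ) < b.val := by exact_mod_cast hab
  have h2 : (b.val : ℝ) < n := by exact_mod_cast b.isLt
  have h3 : (0 : ℝ) ≤ a.val := by positivity
  rw [← sub_div]
  constructor
  · apply div_pos <;> linarith
  · rw [div_lt_one h0]
    linarith

/-- The wall crossed at `p` is the upper boundary of the strip from `alcove_bounds`, because the
level is one more than the number of earlier occurrences. The unfolded path therefore always
approaches its wall from below. -/
theorem sub_lt_level_of_mem_alcoveBefore (h : StrictAnti lam) (p : Pos lam) {x : Fin n → ℝ}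
    (hx : x ∈ alcoveBefore lam p) :
    x (entry lam p).lo - x (entry lam p).hi < level lam p := by
  obtain ⟨v, hv, rfl⟩ := hx
  have := (alcove_bounds h p.val p.isLt.le v hv _ _ (entry_lo_lt_hi h p)).2
  rw [level_eq_rootCount]
  have hs : sorted (Finset.univ.filter fun p' : Pos lam => p' < p) =
      (List.finRange (chain lam).length).filter (fun p' => p'.val < p.val) := by
    simp only [sorted, Finset.mem_filter, Finset.mem_univ, true_and, Fin.lt_def]
  rw [hs]
  push_cast
  exact this

/-- Ensures that the existential data in `IsPositiveFolding` are unique, so that one presentation of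
the wall suffices to refute positivity. -/
theorem hyperplane_eq_iff {a b a' b' : Fin n} {c c' : ℤ} (hab : a < b) (hab' : a' < b')
    (heq : hyperplane a b c = hyperplane a' b' c') : a = a' ∧ b = b' ∧ c = c' := by
  have hmem : ∀ v : Fin n → ℝ, v a - v b = c ↔ v a' - v b' = c' := fun v =>
    Set.ext_iff.mp heq v
  have h0 : (Pi.single a (c : ℝ) : Fin n → ℝ) a' - (Pi.single a (c : ℝ) : Fin n → ℝ) b' = c' :=
    (hmem _).1 (by simp [hab.ne'])
  have h2 : ∀ m, m ≠ a → m ≠ b → m ≠ a' ∧ m ≠ b' := by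
    intro m hma hmb
    -- Moving in a direction `m` outside `{a, b}` stays in the first hyperplane but would leave the
    -- second if `m` were `a'` or `b'`.
    have := (hmem (Pi.single a (c : ℝ) + Pi.single m 1)).1
      (by simp [hab.ne', hma.symm, hmb.symm])
    simp only [Pi.add_apply] at this
    constructor
    · rintro rfl
      simp [hab'.ne'] at this h0
      linarith
    · rintro rfl
      simp [hab'.ne] at this h0
      linarith
  have ha' : a' = a ∨ a' = b := by
    by_contra hcon
    push Not at hcon
    exact (h2 a' hcon.1 hcon.2).1 rfl
  have hb' : b' = a ∨ b' = b := by
    by_contra hcon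
    push Not at hcon
    exact (h2 b' hcon.1 hcon.2).2 rfl
  have haa : a = a' := by
    rcases ha' with rfl | rfl
    · rfl
    · rcases hb' with rfl | rfl
      · exact absurd (hab.trans hab') (lt_irrefl _)
      · exact absurd hab' (lt_irrefl _)
  have hbb : b = b' := by
    rcases hb' with rfl | rfl
    · exact absurd (haa ▸ hab') (lt_irrefl _)
    · rfl
  subst haa hbb
  refine ⟨rfl, rfl, ?_⟩
  simp [hab.ne'] at h0
  exact_mod_cast h0

/-- The alcove lies below the wall for the root `(lo, hi)`. The folded map carries this root to
`ε_{u lo} - ε_{u hi}`, so the image is on the positive side exactly when that root is negative. -/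
theorem isPositiveFolding_iff (h : StrictAnti lam) (w : Equiv.Perm (Fin n))
    (J : Finset (Pos lam)) (p : Pos lam) :
    IsPositiveFolding w J p ↔
      (w * phi (J.filter fun p' => p' < p)) (entry lam p).hi <
        (w * phi (J.filter fun p' => p' < p)) (entry lam p).lo := by
  obtain ⟨κ, hκ⟩ := exists_affineWord_apply h (sorted (J.filter fun p' => p' < p))
  set u := w * phi (J.filter fun p' => p' < p) with hu
  have hg : ∀ v x, foldedMap w J p v (u x) = v x + κ (w⁻¹ (u x)) := by
    intro v x
    have hφ : (List.map (refl lam) (sorted (J.filter fun p' => p' < p))).prod =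
      phi (J.filter fun p' => p' < p) := rfl
    simp only [foldedMap, permAct, hκ, hφ]
    simp [hu]
  have hg' : ∀ v x, foldedMap w J p v x = v (u⁻¹ x) + κ (w⁻¹ x) := by
    intro v x
    simpa using hg v (u⁻¹ x)
  set i := (entry lam p).lo with hi
  set l := (entry lam p).hi with hl
  have himg : ∀ c : ℤ, foldedMap w J p '' hyperplane i l c =
      {y : Fin n → ℝ | y (u i) - y (u l) = c + κ (w⁻¹ (u i)) - κ (w⁻¹ (u l))} := by
    intro c
    ext y
    simp only [Set.mem_image, hyperplane, Set.mem_ofPred_eq]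
    constructor
    · rintro ⟨v, hv, rfl⟩
      rw [hg, hg]
      linarith
    · intro hy
      refine ⟨fun x => y (u x) - κ (w⁻¹ (u x)), ?_, ?_⟩
      · linarith
      · funext x
        rw [hg']
        simp
  have hside : ∀ y ∈ foldedMap w J p '' alcoveBefore lam p,
      y (u i) - y (u l) < level lam p + κ (w⁻¹ (u i)) - κ (w⁻¹ (u l)) := by
    rintro y ⟨x, hx, rfl⟩
    have := sub_lt_level_of_mem_alcoveBefore h p hx
    rw [hg, hg]
    linarith
  constructor
  · rintro ⟨a, b, c, hab, hH, hA⟩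
    by_contra hlt
    have hlt : u i < u l :=
      lt_of_le_of_ne (not_lt.mp hlt) fun heq => (entry_lo_lt_hi h p).ne (u.injective heq)
    rw [himg] at hH
    have hH' : hyperplane (u i) (u l) (level lam p + κ (w⁻¹ (u i)) - κ (w⁻¹ (u l))) =
        hyperplane a b c := by
      rw [← hH]
      unfold hyperplane
      push_cast
      rfl
    obtain ⟨rfl, rfl, rfl⟩ := hyperplane_eq_iff hlt hab hH'
    -- An actual point is needed: lying on both sides is contradictory only for a nonempty alcove.
    obtain ⟨v, hv⟩ := exists_mem_fundamentalAlcove n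
    have hmem : foldedMap w J p (affineWord lam
        (sorted (Finset.univ.filter fun p' => p' < p)).reverse v) ∈
        foldedMap w J p '' alcoveBefore lam p := Set.mem_image_of_mem _ (Set.mem_image_of_mem _ hv)
    have h1 := hA hmem
    have h2 := hside _ hmem
    simp only [Set.mem_ofPred_eq] at h1
    push_cast at h1
    linarith
  · intro hlt
    refine ⟨u l, u i, -(level lam p + κ (w⁻¹ (u i)) - κ (w⁻¹ (u l))), hlt, ?_, ?_⟩
    · rw [himg]
      ext y
      simp only [hyperplane, Set.mem_ofPred_eq]
      push_cast
      constructor <;> intro hy <;> linarith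
    · intro y hy
      have := hside y hy
      simp only [Set.mem_ofPred_eq]
      push_cast
      linarith

/-! ### The weight of a folding pair -/

theorem sorted_filter (J : Finset (Pos lam)) (P : Pos lam → Prop) [DecidablePred P] :
    sorted (J.filter P) = (sorted J).filter (fun p => P p) := by
  simp only [sorted, List.filter_filter, Finset.mem_filter]
  congr 1
  funext p
  by_cases h1 : p ∈ J <;> by_cases h2 : P p <;> simp [h1, h2]

theorem pairwise_sorted (J : Finset (Pos lam)) : (sorted J).Pairwise (· < ·) :=
  (List.pairwise_lt_finRange _).filter _

theorem col_le_of_lt (lam : Fin n → ℕ) {p p' : Pos lam} (h : p < p') :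
    (entry lam p').col ≤ (entry lam p).col := by
  have := (entry_before_iff lam).2 h
  unfold EntryBefore at this
  omega

theorem sum_column_indicator (lam : Fin n → ℕ) (x : Fin n) {c : ℕ} (hc : 1 ≤ c) :
    ∑ j ∈ Finset.Icc 1 (numCols lam), (if c ≤ j then (if j ≤ lam x then (1 : ℤ) else 0) else 0) =
      ((lam x + 1 - c : ℕ) : ℤ) := by
  have := le_numCols lam x
  simp only [← ite_and]
  rw [Finset.sum_boole, ← Nat.card_Icc]
  congr 2
  ext j
  simp only [Finset.mem_filter, Finset.mem_Icc]
  omega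

/-- Think of `lam` as a sum of column indicators. A linear reflection would permute all columns; the
affine shift by the level `lam lo - col + 1` restores the columns `j ≥ col`, in which row `lo` is
present and row `hi` absent. Since `col` decreases weakly along the chain, those columns are
untouched by the remaining reflections. -/
theorem affineWord_lam (h : StrictAnti lam) (ps : List (Pos lam)) (hps : ps.Pairwise (· < ·))
    (x : Fin n) :
    affineWord lam ps (fun i => (lam i : ℤ)) x = ∑ j ∈ Finset.Icc 1 (numCols lam),
      if j ≤ lam (((ps.filter fun p => j < (entry lam p).col).map (refl lam)).prod⁻¹ x)
        then (1 : ℤ) else 0 := by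
  induction ps generalizing x with
  | nil =>
    have := sum_column_indicator lam x le_rfl
    simp only [affineWord, List.foldr_nil, List.filter_nil, List.map_nil, List.prod_nil, inv_one,
      Equiv.Perm.one_apply]
    rw [Nat.add_sub_cancel] at this
    rw [← this]
    refine Finset.sum_congr rfl fun j hj => ?_
    rw [if_pos (Finset.mem_Icc.mp hj).1]
  | cons p ps ih =>
    rw [List.pairwise_cons] at hps
    have hcons : affineWord lam (p :: ps) (fun i => (lam i : ℤ)) =
      affineRefl (entry lam p).lo (entry lam p).hi (level lam p)
        (affineWord lam ps fun i => (lam i : ℤ)) := rfl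
    have hlt := entry_lo_lt_hi h p
    have hmem := (mem_chain h).1 (entry_mem lam p)
    have hlev := level_eq h p
    rw [hcons, affineRefl_apply hlt.ne, ih hps.2, hlev]
    set s := Equiv.swap (entry lam p).lo (entry lam p).hi with hs
    set c := (entry lam p).col with hc
    -- For `j ≥ c` no reflection of the list acts on column `j`, and the correction undoes the swap;
    -- for `j < c` the swap is genuine and the correction vanishes.
    have hdiff : ∀ j, (if j ≤ lam ((((p :: ps).filter fun p => j < (entry lam p).col).map
          (refl lam)).prod⁻¹ x) then (1 : ℤ) else 0) =
        (if j ≤ lam (((ps.filter fun p => j < (entry lam p).col).map (refl lam)).prod⁻¹ (s x))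
          then (1 : ℤ) else 0) +
        ((if c ≤ j then (if j ≤ lam x then (1 : ℤ) else 0) else 0) -
          (if c ≤ j then (if j ≤ lam (s x) then (1 : ℤ) else 0) else 0)) := by
      intro j
      by_cases hj : c ≤ j
      · have h1 : ((p :: ps).filter fun p => j < (entry lam p).col) = [] := by
          rw [List.filter_eq_nil_iff]
          intro p' hp'
          rcases List.mem_cons.mp hp' with rfl | hp'
          · simpa using hj
          · have := col_le_of_lt lam (hps.1 p' hp')
            simp only [decide_eq_true_eq]
            omega
        have h2 : (ps.filter fun p => j < (entry lam p).col) = [] := by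
          rw [List.filter_cons] at h1
          split_ifs at h1
          exact h1
        rw [h1, h2]
        simp [hj]
      · have h1 : ((p :: ps).filter fun p => j < (entry lam p).col) =
            p :: (ps.filter fun p => j < (entry lam p).col) := by
          rw [List.filter_cons, if_pos]
          simpa using hj
        rw [h1]
        simp [hj, refl, hs]
    rw [Finset.sum_congr rfl fun j _ => hdiff j, Finset.sum_add_distrib, Finset.sum_sub_distrib,
      sum_column_indicator lam x (by omega), sum_column_indicator lam (s x) (by omega)]
    congr 1
    rcases eq_or_ne x (entry lam p).lo with hx | hx
    · rw [hx, hs, Equiv.swap_apply_left, if_pos rfl, if_neg hlt.ne]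
      push_cast
      omega
    · rcases eq_or_ne x (entry lam p).hi with hx' | hx'
      · rw [hx', hs, Equiv.swap_apply_right, if_pos rfl, if_neg hlt.ne']
        push_cast
        omega
      · rw [hs, Equiv.swap_apply_of_ne_of_ne hx hx', if_neg hx, if_neg hx']
        simp

/-- Each permutation `piPerm w J j` is injective, so a value `a` occurs at most once in column `j`
of the filling, namely when its preimage is a row meeting that column. Both sides count these
columns. -/
theorem permAct_mu (h : StrictAnti lam) (w : Equiv.Perm (Fin n)) (J : Finset (Pos lam)) :
    permAct w (mu J) = content (fillingMap lam w J) := by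
  funext a
  have hmu : ∀ j, ((((sorted J).filter fun p => j < (entry lam p).col).map (refl lam)).prod⁻¹
      (w⁻¹ a)) = (piPerm w J j)⁻¹ a := by
    intro j
    rw [piPerm, phi, sorted_filter]
    simp
  simp only [permAct, mu, affineWord_lam h _ (pairwise_sorted J), hmu, content]
  rw [Finset.sum_boole]
  congr 1
  symm
  refine Finset.card_bij (fun u _ => u.1.2) ?_ ?_ ?_
  · rintro ⟨⟨i, j⟩, hu⟩ hf
    replace hf : piPerm w J j i = a := (Finset.mem_filter.mp hf).2
    rw [mem_diagram] at hu
    have := le_numCols lam i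
    simp only at hu ⊢
    have hinv : (piPerm w J j)⁻¹ a = i := by rw [← hf]; simp
    rw [Finset.mem_filter, Finset.mem_Icc, hinv]
    omega
  · rintro ⟨⟨i, j⟩, hu⟩ hf ⟨⟨i', j'⟩, hu'⟩ hf' heq
    replace hf : piPerm w J j i = a := (Finset.mem_filter.mp hf).2
    replace hf' : piPerm w J j' i' = a := (Finset.mem_filter.mp hf').2
    simp only at heq
    subst heq
    have := (piPerm w J j).injective (hf.trans hf'.symm)
    subst this
    rfl
  · intro j hj
    rw [Finset.mem_filter, Finset.mem_Icc] at hj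
    refine ⟨⟨((piPerm w J j)⁻¹ a, j), mem_diagram.mpr ⟨hj.1.1, hj.2⟩⟩, ?_, rfl⟩
    exact Finset.mem_filter.mpr ⟨Finset.mem_univ _, by simp [fillingMap]⟩

/-! ### Lengths -/

/-- The number of positions `m` with `i < m < l` at which `v` takes a value strictly between
`a` and `b`. -/
def betweenCount (v : Fin n → Fin n) (i : Fin n) (l : ℕ) (a b : Fin n) : ℕ :=
  (Finset.univ.filter fun m : Fin n => i < m ∧ m.val < l ∧
    ((a < v m ∧ v m < b) ∨ (b < v m ∧ v m < a))).card

theorem sum_pairs_of_support {i l : Fin n} (hil : i ≠ l) (f : Fin n → Fin n → ℤ)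
    (hoff : ∀ a b, a ≠ i → a ≠ l → b ≠ i → b ≠ l → f a b = 0)
    (hi : f i i = 0) (hl : f l l = 0) :
    ∑ a, ∑ b, f a b = f i l + f l i +
      ∑ m ∈ Finset.univ.filter (fun m => m ≠ i ∧ m ≠ l), (f i m + f l m + f m i + f m l) := by
  have hsplit : ∀ g : Fin n → ℤ, ∑ b, g b = g i + g l +
      ∑ m ∈ Finset.univ.filter (fun m => m ≠ i ∧ m ≠ l), g m := by
    intro g
    rw [← Finset.add_sum_erase _ _ (Finset.mem_univ i),
      ← Finset.add_sum_erase _ _ (Finset.mem_erase.mpr ⟨hil.symm, Finset.mem_univ l⟩), ← add_assoc]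
    congr 2
    ext m
    simp [and_comm]
  have hrow : ∀ a ∈ Finset.univ.filter (fun m => m ≠ i ∧ m ≠ l), ∑ b, f a b = f a i + f a l := by
    intro a ha
    simp only [Finset.mem_filter, Finset.mem_univ, true_and] at ha
    rw [hsplit, Finset.sum_eq_zero, add_zero]
    intro b hb
    simp only [Finset.mem_filter, Finset.mem_univ, true_and] at hb
    exact hoff a b ha.1 ha.2 hb.1 hb.2
  rw [hsplit, Finset.sum_congr rfl hrow, hsplit (f i), hsplit (f l), hi, hl]
  simp only [Finset.sum_add_distrib]
  ring

theorem permLength_eq_sum (v : Equiv.Perm (Fin n)) :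
    (permLength v : ℤ) = ∑ a, ∑ b, if a < b ∧ v b < v a then (1 : ℤ) else 0 := by
  rw [← Finset.sum_product', Finset.univ_product_univ, Finset.sum_boole]
  rfl

/-- Only pairs meeting `{i, l}` can change status. The pair `(i, l)` gives one new inversion, and
each position with an intermediate value gives two. -/
theorem permLength_mul_swap {v : Equiv.Perm (Fin n)} {i l : Fin n} (hil : i < l)
    (hv : v i < v l) :
    permLength (v * Equiv.swap i l) = permLength v + 1 + 2 * betweenCount v i l (v i) (v l) := by
  set s := Equiv.swap i l with hs
  have h1 : (permLength (v * s) : ℤ) =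
      ∑ a, ∑ b, if s a < s b ∧ v b < v a then (1 : ℤ) else 0 := by
    rw [permLength_eq_sum, ← Equiv.sum_comp s]
    refine Finset.sum_congr rfl fun a _ => ?_
    rw [← Equiv.sum_comp s]
    simp [hs]
  have h2 : (permLength (v * s) : ℤ) - permLength v = ∑ a, ∑ b,
      ((if s a < s b ∧ v b < v a then (1 : ℤ) else 0) -
        (if a < b ∧ v b < v a then (1 : ℤ) else 0)) := by
    rw [h1, permLength_eq_sum]
    simp only [Finset.sum_sub_distrib]
  have hsi : s i = l := Equiv.swap_apply_left i l
  have hsl : s l = i := Equiv.swap_apply_right i l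
  have hsm : ∀ m, m ≠ i → m ≠ l → s m = m := fun m => Equiv.swap_apply_of_ne_of_ne
  rw [sum_pairs_of_support hil.ne] at h2
  -- For `m` outside the interval the pairs with `i` and `l` trade places. Inside it, their changes
  -- cancel unless `v m` lies between `v i` and `v l`.
  · have h3 : ∀ m ∈ Finset.univ.filter (fun m => m ≠ i ∧ m ≠ l),
        (((if s i < s m ∧ v m < v i then (1 : ℤ) else 0) -
          (if i < m ∧ v m < v i then (1 : ℤ) else 0)) +
        ((if s l < s m ∧ v m < v l then (1 : ℤ) else 0) -
          (if l < m ∧ v m < v l then (1 : ℤ) else 0)) +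
        ((if s m < s i ∧ v i < v m then (1 : ℤ) else 0) -
          (if m < i ∧ v i < v m then (1 : ℤ) else 0)) +
        ((if s m < s l ∧ v l < v m then (1 : ℤ) else 0) -
          (if m < l ∧ v l < v m then (1 : ℤ) else 0))) =
        2 * if i < m ∧ m < l ∧ v i < v m ∧ v m < v l then (1 : ℤ) else 0 := by
      intro m hm
      simp only [Finset.mem_filter, Finset.mem_univ, true_and] at hm
      rw [hsi, hsl, hsm m hm.1 hm.2]
      have hmi : v m ≠ v i := fun hc => hm.1 (v.injective hc)
      have hml : v m ≠ v l := fun hc => hm.2 (v.injective hc)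
      rcases lt_or_gt_of_ne hm.1 with c1 | c1
      · simp [c1, c1.trans hil, c1.not_gt, (c1.trans hil).not_gt]
      · rcases lt_or_gt_of_ne hm.2 with c2 | c2
        · rcases lt_or_gt_of_ne hmi with c3 | c3
          · simp [c1, c2, c1.not_gt, c2.not_gt, c3, c3.not_gt, c3.trans hv, (c3.trans hv).not_gt]
          · rcases lt_or_gt_of_ne hml with c4 | c4
            · simp [c1, c2, c1.not_gt, c2.not_gt, c3, c3.not_gt, c4, c4.not_gt]
            · simp [c1, c2, c1.not_gt, c2.not_gt, c3, c3.not_gt, c4, c4.not_gt]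
        · simp [c1, c2, c1.not_gt, c2.not_gt]
    rw [Finset.sum_congr rfl h3, ← Finset.mul_sum, Finset.sum_boole] at h2
    simp only [hsi, hsl, hil, hil.not_gt, hv, hv.not_gt, and_false, and_true, if_false,
      if_true] at h2
    have h4 : ((Finset.univ.filter fun m => m ≠ i ∧ m ≠ l).filter
        fun m => i < m ∧ m < l ∧ v i < v m ∧ v m < v l).card = betweenCount v i l (v i) (v l) := by
      unfold betweenCount
      rw [Finset.filter_filter]
      congr 1
      ext m
      simp only [Finset.mem_filter, Finset.mem_univ, true_and]
      constructor
      · rintro ⟨_, h1, h2, h3⟩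
        exact ⟨h1, h2, Or.inl h3⟩
      · rintro ⟨h1, h2, h3 | h3⟩
        · exact ⟨⟨h1.ne', ne_of_lt h2⟩, h1, h2, h3⟩
        · exact absurd (h3.1.trans h3.2) hv.not_gt
    rw [h4] at h2
    omega
  · intro a b ha ha' hb hb'
    rw [hsm a ha ha', hsm b hb hb', sub_self]
  · simp
  · simp

/-- The exponent `(ℓ(v s) - ℓ(v) - 1) / 2`, where `s` is the transposition of `i` and `l`. -/
def stepExponent (v : Equiv.Perm (Fin n)) (i l : Fin n) : ℤ :=
  if v i < v l then betweenCount v i l (v i) (v l) else -1 - betweenCount v i l (v i) (v l)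

theorem betweenCount_comm (v : Fin n → Fin n) (i : Fin n) (l : ℕ) (a b : Fin n) :
    betweenCount v i l a b = betweenCount v i l b a := by
  unfold betweenCount
  congr 1
  ext m
  simp only [Finset.mem_filter, Finset.mem_univ, true_and]
  rw [or_comm]

theorem betweenCount_congr {v v' : Fin n → Fin n} {i : Fin n} {l : ℕ} {a b : Fin n}
    (h : ∀ m : Fin n, i < m → m.val < l → v m = v' m) :
    betweenCount v i l a b = betweenCount v' i l a b := by
  unfold betweenCount
  congr 1
  ext m
  simp only [Finset.mem_filter, Finset.mem_univ, true_and]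
  constructor <;> rintro ⟨h1, h2, h3⟩
  · exact ⟨h1, h2, by rwa [← h m h1 h2]⟩
  · exact ⟨h1, h2, by rwa [h m h1 h2]⟩

theorem permLength_step (v : Equiv.Perm (Fin n)) {i l : Fin n} (hil : i < l) :
    (permLength (v * Equiv.swap i l) : ℤ) - permLength v - 1 = 2 * stepExponent v i l := by
  unfold stepExponent
  split_ifs with hv
  · rw [permLength_mul_swap hil hv]
    push_cast
    ring
  · have hne : v i ≠ v l := fun hc => hil.ne (v.injective hc)
    have hlt : v l < v i := lt_of_le_of_ne (not_lt.mp hv) hne.symm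
    -- A descent of `v` is an ascent of the swapped permutation, and the two have the same values
    -- strictly between `i` and `l`.
    have := permLength_mul_swap (v := v * Equiv.swap i l) hil (by simpa using hlt)
    rw [mul_assoc, Equiv.swap_mul_self, mul_one] at this
    rw [this]
    have h2 : betweenCount ⇑(v * Equiv.swap i l) i l ((v * Equiv.swap i l) i)
        ((v * Equiv.swap i l) l) = betweenCount v i l (v i) (v l) := by
      rw [betweenCount_comm, betweenCount_congr (v' := v)]
      · simp
      · intro m h1 h2
        simp [Equiv.swap_apply_of_ne_of_ne h1.ne' (ne_of_lt h2)]
    rw [h2]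
    push_cast
    ring

variable {K : Type*} [Field K]

/-! ### Sums over sublists -/

/-- The sum of `G` over all sublists of a list, taken with multiplicity. -/
def subSum {α : Type*} : List α → (List α → K) → K
  | [], G => G []
  | a :: L, G => subSum L G + subSum L (fun s => G (a :: s))

theorem subSum_congr {α : Type*} (L : List α) {G G' : List α → K}
    (h : ∀ s, s.Sublist L → G s = G' s) : subSum L G = subSum L G' := by
  induction L generalizing G G' with
  | nil => exact h [] (List.Sublist.refl _)
  | cons a L ih =>
    simp only [subSum]
    rw [ih fun s hs => h s (hs.cons a), ih fun s hs => h (a :: s) (hs.cons_cons a)]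

theorem subSum_add {α : Type*} (L : List α) (G G' : List α → K) :
    subSum L (fun s => G s + G' s) = subSum L G + subSum L G' := by
  induction L generalizing G G' with
  | nil => rfl
  | cons a L ih =>
    simp only [subSum, ih]
    ring

theorem subSum_mul {α : Type*} (L : List α) (c : K) (G : List α → K) :
    subSum L (fun s => c * G s) = c * subSum L G := by
  induction L generalizing G with
  | nil => rfl
  | cons a L ih =>
    simp only [subSum, ih]
    ring

theorem subSum_append {α : Type*} (L L' : List α) (G : List α → K) :
    subSum (L ++ L') G = subSum L (fun s => subSum L' (fun s' => G (s ++ s'))) := by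
  induction L generalizing G with
  | nil => rfl
  | cons a L ih =>
    simp only [subSum, List.cons_append, ih]

theorem subSum_comm {α β : Type*} (L : List α) (L' : List β) (G : List α → List β → K) :
    subSum L (fun s => subSum L' (fun s' => G s s')) =
      subSum L' (fun s' => subSum L (fun s => G s s')) := by
  induction L generalizing G with
  | nil => rfl
  | cons a L ih =>
    simp only [subSum, ih, subSum_add]

theorem sum_finset_fin_succ {m : ℕ} (F : Finset (Fin (m + 1)) → K) :
    ∑ J, F J = ∑ J : Finset (Fin m), F (J.map (Fin.succEmb m)) +
      ∑ J : Finset (Fin m), F (insert 0 (J.map (Fin.succEmb m))) := by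
  rw [← Finset.sum_filter_add_sum_filter_not Finset.univ (fun J => (0 : Fin (m + 1)) ∉ J)]
  congr 1
  · refine Finset.sum_nbij' (fun J => Finset.univ.filter fun k => Fin.succ k ∈ J)
      (fun J => J.map (Fin.succEmb m)) ?_ ?_ ?_ ?_ ?_
    · simp
    · intro J _
      simp [Fin.succ_ne_zero]
    · intro J hJ
      ext k
      refine Fin.cases ?_ (fun k => ?_) k
      · simpa [Fin.succ_ne_zero] using hJ
      · simp
    · intro J _
      ext k
      simp
    · intro J hJ
      congr 1
      ext k
      refine Fin.cases ?_ (fun k => ?_) k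
      · simpa [Fin.succ_ne_zero] using hJ
      · simp
  · refine Finset.sum_nbij' (fun J => Finset.univ.filter fun k => Fin.succ k ∈ J)
      (fun J => insert 0 (J.map (Fin.succEmb m))) ?_ ?_ ?_ ?_ ?_
    · simp
    · intro J _
      simp
    · intro J hJ
      ext k
      refine Fin.cases ?_ (fun k => ?_) k
      · simpa using hJ
      · simp [Fin.succ_ne_zero]
    · intro J _
      ext k
      simp [Fin.succ_ne_zero]
    · intro J hJ
      congr 1
      ext k
      refine Fin.cases ?_ (fun k => ?_) k
      · simpa using hJ
      · simp [Fin.succ_ne_zero]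

/-- Passing from position sets to sublists makes the sum compatible with splitting the chain by
concatenation. -/
theorem sum_finset_eq_subSum {α : Type*} (L : List α) (G : List α → K) :
    ∑ J : Finset (Fin L.length), G (((List.finRange L.length).filter fun p => p ∈ J).map L.get) =
      subSum L G := by
  induction L generalizing G with
  | nil =>
    rw [show (Finset.univ : Finset (Finset (Fin ([] : List α).length))) = {∅} from rfl,
      Finset.sum_singleton]
    rfl
  | cons a L ih =>
    rw [subSum, ← ih, ← ih]
    refine (sum_finset_fin_succ (m := L.length) _).trans ?_
    congr 1
    · refine Finset.sum_congr rfl fun J _ => ?_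
      congr 1
      simp only [List.length_cons, List.finRange_succ]
      rw [List.filter_cons, if_neg (by simp [Fin.succ_ne_zero]), List.filter_map, List.map_map]
      congr 1
      refine List.filter_congr fun k _ => ?_
      simp
    · refine Finset.sum_congr rfl fun J _ => ?_
      congr 1
      simp only [List.length_cons, List.finRange_succ]
      rw [List.filter_cons, if_pos (by simp), List.filter_map, List.map_cons, List.map_map]
      congr 2
      refine List.filter_congr fun k _ => ?_
      simp [Fin.succ_ne_zero]

/-! ### Coefficients of folding pairs -/

/-- The transposition of an entry. -/
def entrySwap (e : Entry n) : Equiv.Perm (Fin n) := Equiv.swap e.lo e.hi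

/-- The factor `q^{arm(i, j-1)} t^{k-i}` attached to an entry. -/
def entryFactor (lam : Fin n → ℕ) (q t : K) (e : Entry n) : K :=
  q ^ arm lam (e.lo, e.col - 1) * t ^ (e.hi.val - e.lo.val)

/-- The contribution of a folding at `e` that leads to the permutation `v`. -/
def stepCoeff (lam : Fin n → ℕ) (q t : K) (e : Entry n) (v : Equiv.Perm (Fin n)) : K :=
  t ^ stepExponent v e.lo e.hi * (1 - t) *
    ((if v e.lo < v e.hi then 1 else entryFactor lam q t e) / (1 - entryFactor lam q t e))

/-- The product of the contributions of the foldings in a list, starting from `w`. -/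
def walkCoeff (lam : Fin n → ℕ) (q t : K) : Equiv.Perm (Fin n) → List (Entry n) → K
  | _, [] => 1
  | w, e :: s => stepCoeff lam q t e (w * entrySwap e) * walkCoeff lam q t (w * entrySwap e) s

theorem walkCoeff_append (q t : K) (w : Equiv.Perm (Fin n)) (s s' : List (Entry n)) :
    walkCoeff lam q t w (s ++ s') =
      walkCoeff lam q t w s * walkCoeff lam q t (w * (s.map entrySwap).prod) s' := by
  induction s generalizing w with
  | nil => simp [walkCoeff]
  | cons e s ih =>
    simp only [List.cons_append, walkCoeff, ih, List.map_cons, List.prod_cons, mul_assoc]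

/-- The length differences telescope along the walk, and each of them is odd. Keeping the witness
`E` avoids integer division by two until `weight` is unfolded. -/
theorem walkCoeff_map_entry (h : StrictAnti lam) (q t : K) (ht : t ≠ 0) (w : Equiv.Perm (Fin n))
    (ps : List (Pos lam)) (hps : ps.Pairwise (· < ·)) :
    ∃ E : ℤ, (permLength w : ℤ) - permLength (w * (ps.map (refl lam)).prod) - ps.length = 2 * E ∧
      walkCoeff lam q t w (ps.map (entry lam)) = t ^ E * (1 - t) ^ ps.length *
        (ps.map fun p =>
          (if (w * ((ps.filter fun p' => p' < p).map (refl lam)).prod) (entry lam p).hi <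
              (w * ((ps.filter fun p' => p' < p).map (refl lam)).prod) (entry lam p).lo
            then 1 else qtFactor lam q t p) / (1 - qtFactor lam q t p)).prod := by
  -- The sign of a folding depends on the foldings before it, so detaching the last one leaves all
  -- other factors unchanged.
  induction ps using List.reverseRecOn with
  | nil => exact ⟨0, by simp, by simp [walkCoeff]⟩
  | append_singleton ps p ih =>
    rw [List.pairwise_append] at hps
    obtain ⟨E, hE, hW⟩ := ih hps.1
    have hlt : ∀ p' ∈ ps, p' < p := fun p' hp' => hps.2.2 p' hp' p (by simp)
    set u := w * (ps.map (refl lam)).prod with hu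
    have hil := entry_lo_lt_hi h p
    have hstep := permLength_step (u * refl lam p) hil
    rw [show Equiv.swap (entry lam p).lo (entry lam p).hi = refl lam p from rfl, mul_assoc,
      show refl lam p * refl lam p = 1 from Equiv.swap_mul_self _ _, mul_one] at hstep
    refine ⟨E + stepExponent (u * refl lam p) (entry lam p).lo (entry lam p).hi, ?_, ?_⟩
    · rw [List.map_append, List.prod_append, ← mul_assoc, ← hu]
      simp only [List.map_cons, List.map_nil, List.prod_singleton, List.length_append,
        List.length_singleton]
      push_cast
      linarith
    · have hprod : (ps.map (entry lam)).map entrySwap = ps.map (refl lam) := by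
        rw [List.map_map]
        rfl
      have hmap : (ps.map fun p₁ =>
          (if (w * (((ps ++ [p]).filter fun p' => p' < p₁).map (refl lam)).prod)
              (entry lam p₁).hi <
              (w * (((ps ++ [p]).filter fun p' => p' < p₁).map (refl lam)).prod) (entry lam p₁).lo
            then 1 else qtFactor lam q t p₁) / (1 - qtFactor lam q t p₁)) = (ps.map fun p₁ =>
          (if (w * ((ps.filter fun p' => p' < p₁).map (refl lam)).prod) (entry lam p₁).hi <
              (w * ((ps.filter fun p' => p' < p₁).map (refl lam)).prod) (entry lam p₁).lo
            then 1 else qtFactor lam q t p₁) / (1 - qtFactor lam q t p₁)) := by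
        refine List.map_congr_left fun p₁ hp₁ => ?_
        have hfilter : (ps ++ [p]).filter (fun p' => p' < p₁) = ps.filter fun p' => p' < p₁ := by
          rw [List.filter_append, (List.filter_eq_nil_iff (l := [p])).mpr, List.append_nil]
          simpa using (hlt p₁ hp₁).le
        rw [hfilter]
      have hlast : (ps ++ [p]).filter (fun p' => p' < p) = ps := by
        rw [List.filter_append, List.filter_cons, if_neg (by simp), List.filter_nil,
          List.append_nil, List.filter_eq_self]
        intro p' hp'
        simpa using hlt p' hp'
      rw [List.map_append, walkCoeff_append, hW, hprod, ← hu, List.map_append, List.prod_append,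
        hmap, List.map_singleton, List.map_singleton, List.prod_singleton, hlast, ← hu,
        zpow_add₀ ht, List.length_append, List.length_singleton, pow_succ]
      simp only [walkCoeff, mul_one, stepCoeff]
      have hswap : u * entrySwap (entry lam p) = u * refl lam p := rfl
      have hlo : (u * refl lam p) (entry lam p).lo = u (entry lam p).hi := by simp [refl]
      have hhi : (u * refl lam p) (entry lam p).hi = u (entry lam p).lo := by simp [refl]
      have hf : entryFactor lam q t (entry lam p) = qtFactor lam q t p := rfl
      rw [hswap, hlo, hhi, hf]
      ring

theorem weight_eq_walkCoeff (h : StrictAnti lam) (q t : K) (ht : t ≠ 0) (w : Equiv.Perm (Fin n))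
    (J : Finset (Pos lam)) :
    weight q t w J = walkCoeff lam q t w ((sorted J).map (entry lam)) := by
  classical
  obtain ⟨E, hE, hW⟩ := walkCoeff_map_entry h q t ht w (sorted J) (pairwise_sorted J)
  have hnodup : (sorted J).Nodup := (List.nodup_finRange _).filter _
  have hfin : (sorted J).toFinset = J := by
    ext p
    simp [sorted]
  have hlen : (sorted J).length = J.card := by
    rw [← List.toFinset_card_of_nodup hnodup, hfin]
  rw [hlen] at hE hW
  -- `hE` presents the numerator of the exponent as `2 * E`, so the division in `weight` is exact.
  rw [hW, ← List.prod_toFinset _ hnodup, hfin, weight, phi, hE,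
    Int.mul_ediv_cancel_left _ (by norm_num), mul_assoc]
  congr 1
  rw [Jpos, Jneg, ← Finset.prod_ite]
  refine Finset.prod_congr rfl fun p _ => ?_
  simp only [isPositiveFolding_iff h, phi, sorted_filter]
  split_ifs <;> rfl

/-- The effect on functions of permutations of allowing a folding at `e`. -/
def foldStep (lam : Fin n → ℕ) (q t : K) (F : Equiv.Perm (Fin n) → K) (e : Entry n) :
    Equiv.Perm (Fin n) → K :=
  fun v => F v + stepCoeff lam q t e v * F (v * entrySwap e)

/-- With the end `v` fixed, the last entry of the list is undone first: either there was no folding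
and the walk of the shorter list ends at `v`, or there was one and it ends at `v` times the
transposition. The left fold therefore acts outermost with the last entry. -/
theorem subSum_walkCoeff (q t : K) (L : List (Entry n)) (F : Equiv.Perm (Fin n) → K)
    (v : Equiv.Perm (Fin n)) :
    subSum L (fun s => walkCoeff lam q t (v * (s.map entrySwap).prod⁻¹) s *
      F (v * (s.map entrySwap).prod⁻¹)) = L.foldl (foldStep lam q t) F v := by
  induction L using List.reverseRecOn generalizing v with
  | nil => simp [subSum, walkCoeff]
  | append_singleton L e ih =>
    rw [subSum_append, List.foldl_append, List.foldl_cons, List.foldl_nil, foldStep, ← ih, ← ih]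
    simp only [subSum, subSum_add, List.append_nil]
    rw [← subSum_mul]
    congr 1
    refine subSum_congr L fun s _ => ?_
    have hsw : (entrySwap e)⁻¹ = entrySwap e := Equiv.swap_inv _ _
    have hss : entrySwap e * entrySwap e = 1 := Equiv.swap_mul_self _ _
    rw [walkCoeff_append]
    simp only [List.map_append, List.map_cons, List.map_nil, List.prod_append,
      List.prod_singleton, mul_inv_rev, hsw, walkCoeff, mul_one]
    rw [← mul_assoc v, inv_mul_cancel_right, mul_assoc v _ (entrySwap e), hss, mul_one]
    ring

/-! ### Recursion over columns -/

/-- The part of the chain in columns larger than `j`. -/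
def chainAbove (lam : Fin n → ℕ) (j : ℕ) : List (Entry n) :=
  (List.range' (j + 1) (numCols lam - j)).reverse.flatMap fun j =>
    (segment lam j).map fun β => ⟨j, β.1, β.2⟩

theorem chainAbove_one (lam : Fin n → ℕ) : chainAbove lam 1 = chain lam := rfl

theorem chainAbove_eq_append (lam : Fin n → ℕ) {j : ℕ} (hj : j < numCols lam) :
    chainAbove lam j = chainAbove lam (j + 1) ++
      (segment lam (j + 1)).map fun β => ⟨j + 1, β.1, β.2⟩ := by
  unfold chainAbove
  rw [show numCols lam - j = (numCols lam - (j + 1)) + 1 by omega, List.range'_succ,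
    List.reverse_cons, List.flatMap_append]
  simp

theorem col_of_mem_chainAbove {j : ℕ} {e : Entry n} (he : e ∈ chainAbove lam j) : j < e.col := by
  simp only [chainAbove, List.mem_flatMap, List.mem_reverse, List.mem_range'_1,
    List.mem_map] at he
  obtain ⟨j', hj', β, _, rfl⟩ := he
  exact hj'.1

/-- The permutation `v` restricts to column `j` of the filling. -/
def ColMatch (σ : Filling lam) (j : ℕ) (v : Equiv.Perm (Fin n)) : Prop :=
  ∀ u : {u : Fin n × ℕ // u ∈ diagram lam}, u.1.2 = j → v u.1.1 = σ u

/-- The walk from `w` given by `s` produces the columns of the filling from column `j` on. -/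
def MatchesFrom (σ : Filling lam) (j : ℕ) (w : Equiv.Perm (Fin n)) (s : List (Entry n)) : Prop :=
  ∀ u : {u : Fin n × ℕ // u ∈ diagram lam}, j ≤ u.1.2 →
    (w * ((s.filter fun e => u.1.2 < e.col).map entrySwap).prod) u.1.1 = σ u

open Classical in
/-- The sum of the coefficients of all walks that end at `v` and produce the columns of the filling
from column `j` on. -/
noncomputable def colSum (q t : K) (σ : Filling lam) (j : ℕ) (v : Equiv.Perm (Fin n)) : K :=
  subSum (chainAbove lam j) fun s =>
    (if MatchesFrom σ j (v * (s.map entrySwap).prod⁻¹) s then 1 else 0) *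
      walkCoeff lam q t (v * (s.map entrySwap).prod⁻¹) s

/-- Foldings in segment `j + 1` affect only columns `k ≤ j`. The columns beyond `j` are thus a
condition on `s` alone, and column `j` is a condition on the end of the walk alone. -/
theorem matchesFrom_append {σ : Filling lam} {j : ℕ} {w : Equiv.Perm (Fin n)}
    {s s' : List (Entry n)} (hs : ∀ e ∈ s, j + 1 < e.col) (hs' : ∀ e ∈ s', e.col = j + 1) :
    MatchesFrom σ j w (s ++ s') ↔
      ColMatch σ j (w * ((s ++ s').map entrySwap).prod) ∧ MatchesFrom σ (j + 1) w s := by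
  have hall : ((s ++ s').filter fun e => j < e.col) = s ++ s' := by
    rw [List.filter_eq_self]
    intro e he
    rcases List.mem_append.mp he with he | he
    · have := hs e he
      simp only [decide_eq_true_eq]
      omega
    · have := hs' e he
      simp only [decide_eq_true_eq]
      omega
  have hlater : ∀ k, j + 1 ≤ k → ((s ++ s').filter fun e => k < e.col) =
      s.filter fun e => k < e.col := by
    intro k hk
    rw [List.filter_append, (List.filter_eq_nil_iff (l := s')).mpr, List.append_nil]
    intro e he
    have := hs' e he
    simp only [decide_eq_true_eq]
    omega
  constructor
  · intro hM
    constructor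
    · intro u hu
      have := hM u hu.ge
      rwa [hu, hall] at this
    · intro u hu
      have := hM u (by omega)
      rwa [hlater _ hu] at this
  · rintro ⟨hC, hM⟩ u hu
    rcases hu.eq_or_lt with hu | hu
    · rw [← hu, hall]
      exact hC u hu.symm
    · rw [hlater _ hu]
      exact hM u hu

-- The transfer recursion: segment `j + 1` connects the permutations of columns `j` and `j + 1`, and
-- the indicator for column `j` factors out because the end `v` is fixed.
open Classical in
theorem colSum_eq (q t : K) (σ : Filling lam) {j : ℕ} (hj : j < numCols lam)
    (v : Equiv.Perm (Fin n)) :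
    colSum q t σ j v = (if ColMatch σ j v then 1 else 0) *
      ((segment lam (j + 1)).map fun β => (⟨j + 1, β.1, β.2⟩ : Entry n)).foldl
        (foldStep lam q t) (colSum q t σ (j + 1)) v := by
  rw [← subSum_walkCoeff, colSum, chainAbove_eq_append lam hj, subSum_append, subSum_comm,
    ← subSum_mul]
  refine subSum_congr _ fun s' hs' => ?_
  rw [colSum, ← subSum_mul, ← subSum_mul]
  refine subSum_congr _ fun s hs => ?_
  have h1 : ∀ e ∈ s, j + 1 < e.col := fun e he => col_of_mem_chainAbove (hs.subset he)
  have h2 : ∀ e ∈ s', e.col = j + 1 := by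
    intro e he
    have := hs'.subset he
    simp only [List.mem_map] at this
    obtain ⟨_, _, rfl⟩ := this
    rfl
  rw [walkCoeff_append]
  simp only [matchesFrom_append h1 h2, inv_mul_cancel_right, List.map_append, List.prod_append,
    mul_inv_rev, ← mul_assoc]
  by_cases hC : ColMatch σ j v
  · by_cases hM : MatchesFrom σ (j + 1)
      (v * (s'.map entrySwap).prod⁻¹ * (s.map entrySwap).prod⁻¹) s
    · simp only [hC, hM, and_self, if_true, one_mul]
      ring
    · simp only [hM, and_false, if_false, zero_mul, mul_zero]
  · simp only [hC, false_and, if_false, zero_mul]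

theorem sum_fibre_eq (h : StrictAnti lam) (q t : K) (ht : t ≠ 0) (σ : Filling lam) :
    ∑ P ∈ fibre σ, weight q t P.1 P.2 = ∑ v, colSum q t σ 1 v := by
  classical
  have hfill : ∀ w J, fillingMap lam w J = σ ↔
      MatchesFrom σ 1 w ((sorted J).map (entry lam)) := by
    intro w J
    have hval : ∀ u, fillingMap lam w J u = (w * ((((sorted J).map (entry lam)).filter
        fun e => u.1.2 < e.col).map entrySwap).prod) u.1.1 := by
      intro u
      rw [fillingMap, piPerm, phi, sorted_filter, List.filter_map, List.map_map]
      rfl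
    constructor
    · intro hf u _
      rw [← hf, hval]
    · intro hM
      funext u
      rw [hval]
      exact hM u (mem_diagram.mp u.2).1
  have hprod : ∀ J : Finset (Pos lam), (((sorted J).map (entry lam)).map entrySwap).prod =
      phi J := by
    intro J
    rw [phi, List.map_map]
    rfl
  have hinner : ∀ J : Finset (Pos lam), ∑ w, (if fillingMap lam w J = σ
      then weight q t w J else 0) = ∑ v,
        (if MatchesFrom σ 1 (v * (((sorted J).map (entry lam)).map entrySwap).prod⁻¹)
          ((sorted J).map (entry lam)) then 1 else 0) *
        walkCoeff lam q t (v * (((sorted J).map (entry lam)).map entrySwap).prod⁻¹)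
          ((sorted J).map (entry lam)) := by
    intro J
    -- Substitution of `w = v * (phi J)⁻¹`: the sum now runs over the ends of the walks.
    rw [← Equiv.sum_comp (Equiv.mulRight (phi J)⁻¹)]
    refine Finset.sum_congr rfl fun v _ => ?_
    simp only [Equiv.coe_mulRight, hfill, weight_eq_walkCoeff h q t ht, hprod, ite_mul, one_mul,
      zero_mul]
  have hsum : ∑ P ∈ fibre σ, weight q t P.1 P.2 = ∑ J : Finset (Pos lam), ∑ w,
      (if fillingMap lam w J = σ then weight q t w J else 0) := by
    rw [fibre, Finset.sum_filter, Fintype.sum_prod_type_right]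
  rw [hsum, Finset.sum_congr rfl fun J _ => hinner J, Finset.sum_comm]
  refine Finset.sum_congr rfl fun v _ => ?_
  rw [colSum, chainAbove_one, ← sum_finset_eq_subSum]
  refine Finset.sum_congr rfl fun J _ => ?_
  have hsorted : (sorted J).map (entry lam) = ((List.finRange (chain lam).length).filter
    fun p => p ∈ J).map (chain lam).get := rfl
  rw [hsorted]

/-! ### Summation over one row of a segment -/

theorem betweenCount_succ (v : Fin n → Fin n) {i l : Fin n} (hil : i < l) (a b : Fin n) :
    betweenCount v i (l.val + 1) a b = betweenCount v i l a b +
      if (a < v l ∧ v l < b) ∨ (b < v l ∧ v l < a) then 1 else 0 := by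
  classical
  have hset : (Finset.univ.filter fun m : Fin n => i < m ∧ m.val < l.val + 1 ∧
      ((a < v m ∧ v m < b) ∨ (b < v m ∧ v m < a))) =
      (Finset.univ.filter fun m : Fin n => i < m ∧ m.val < l.val ∧
        ((a < v m ∧ v m < b) ∨ (b < v m ∧ v m < a))) ∪
      (if (a < v l ∧ v l < b) ∨ (b < v l ∧ v l < a) then {l} else ∅) := by
    ext m
    rcases eq_or_ne m l with rfl | hne
    · split_ifs with hc
      · simp [hil, hc]
      · simp only [hc, Finset.mem_filter, and_false, Finset.union_empty]
    · have hval : m.val ≠ l.val := fun h => hne (Fin.ext h)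
      have hlt : m.val < l.val + 1 ↔ m.val < l.val := by omega
      split_ifs with hc
      · simp only [hlt, hne, Finset.mem_filter, Finset.mem_univ, true_and, Finset.mem_union,
          Finset.mem_singleton, or_false]
      · simp only [hlt, Finset.mem_filter, Finset.mem_univ, true_and, Finset.union_empty]
  unfold betweenCount
  rw [hset, Finset.card_union_of_disjoint]
  · split_ifs <;> simp
  · split_ifs <;> simp

/-- Additivity would fail by one if the middle value `b` itself occurred in the range. -/
theorem betweenCount_add (v : Fin n → Fin n) {i : Fin n} {l : ℕ} {a b c : Fin n} (hab : a < b)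
    (hbc : b < c) (hb : ∀ m : Fin n, i < m → m.val < l → v m ≠ b) :
    betweenCount v i l a c = betweenCount v i l a b + betweenCount v i l b c := by
  unfold betweenCount
  rw [← Finset.card_union_of_disjoint]
  · congr 1
    ext m
    simp only [Finset.mem_filter, Finset.mem_univ, true_and, Finset.mem_union]
    have := hb m
    constructor
    · rintro ⟨h1, h2, h3⟩
      have := this h1 h2
      simp only [h1, h2, true_and]
      omega
    · omega
  · rw [Finset.disjoint_left]
    intro m
    simp only [Finset.mem_filter, Finset.mem_univ, true_and]
    omega

/-- The total contribution of the foldings in one row that turn the entry `a` in row `i` into `b`,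
where `N` entries of the column below row `i` lie between `a` and `b`, and `d` is one more than the
leg length. -/
def rowCoeff (Q t : K) (d N : ℕ) (a b : Fin n) : K :=
  if a = b then 1 else
    (if a < b then t ^ (N : ℤ) else t ^ ((d : ℤ) - 1 - N) * Q) * ((1 - t) / (1 - Q * t ^ d))

theorem rowCoeff_self (Q t : K) (d N : ℕ) (a : Fin n) : rowCoeff Q t d N a a = 1 := if_pos rfl

theorem rowCoeff_of_lt (Q t : K) (d N : ℕ) {a b : Fin n} (h : a < b) :
    rowCoeff Q t d N a b = t ^ (N : ℤ) * ((1 - t) / (1 - Q * t ^ d)) := by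
  rw [rowCoeff, if_neg h.ne, if_pos h]

theorem rowCoeff_of_gt (Q t : K) (d N : ℕ) {a b : Fin n} (h : b < a) :
    rowCoeff Q t d N a b = t ^ ((d : ℤ) - 1 - N) * Q * ((1 - t) / (1 - Q * t ^ d)) := by
  rw [rowCoeff, if_neg h.ne', if_neg h.not_gt]

/-- The contribution of a single folding that exchanges `a` and `x`. -/
def swapCoeff (Q t : K) (d N : ℕ) (a x : Fin n) : K :=
  if a < x then t ^ (N : ℤ) * ((1 - t) / (1 - Q * t ^ d))
  else t ^ (-1 - (N : ℤ)) * (Q * t ^ d) * ((1 - t) / (1 - Q * t ^ d))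

/-- Handles the case in which the entry `b` is at the position just added: a single folding already
produces it. -/
theorem swapCoeff_eq_rowCoeff {Q t : K} (ht : t ≠ 0) (d N : ℕ) {a x : Fin n} (h : a ≠ x) :
    swapCoeff Q t d N a x = rowCoeff Q t d N a x := by
  unfold swapCoeff rowCoeff
  rw [if_neg h]
  split_ifs
  · rfl
  · rw [show (d : ℤ) - 1 - N = (-1 - (N : ℤ)) + d by ring, zpow_add₀ ht, zpow_natCast]
    ring

/-- Clearing denominators leaves `t(1 - A) + (1 - t) = 1 - At`. The companion
`rowCoeff_step_of_desc` is `(1 - A) + A(1 - t) = 1 - At`. Here `A` stands for `Q * t ^ d`. -/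
theorem rowCoeff_step_of_asc {A t Z : K} (h1 : 1 - A ≠ 0) (h2 : 1 - A * t ≠ 0) :
    Z * t * ((1 - t) / (1 - A * t)) + Z * ((1 - t) / (1 - A)) * ((1 - t) / (1 - A * t)) =
      Z * ((1 - t) / (1 - A)) := by
  have h3 : 1 - t * A ≠ 0 := by rwa [mul_comm]
  field_simp
  ring

theorem rowCoeff_step_of_desc {A t Z : K} (h1 : 1 - A ≠ 0) (h2 : 1 - A * t ≠ 0) :
    Z * ((1 - t) / (1 - A * t)) + Z * A * ((1 - t) / (1 - A)) * ((1 - t) / (1 - A * t)) =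
      Z * ((1 - t) / (1 - A)) := by
  have h3 : 1 - t * A ≠ 0 := by rwa [mul_comm]
  field_simp
  ring

/-- The recursion behind the summation over a row, for an entry `x` different from `b`. -/
theorem rowCoeff_step {Q t : K} (ht : t ≠ 0) (hQ : ∀ d : ℕ, 1 ≤ d → 1 - Q * t ^ d ≠ 0)
    {d : ℕ} (hd : 1 ≤ d) (v : Fin n → Fin n) (i : Fin n) (l : ℕ) {a x b : Fin n}
    (hab : a ≠ b) (hxb : x ≠ b) (hax : a ≠ x)
    (ha : ∀ m : Fin n, i < m → m.val < l → v m ≠ a)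
    (hx : ∀ m : Fin n, i < m → m.val < l → v m ≠ x)
    (hb : ∀ m : Fin n, i < m → m.val < l → v m ≠ b) :
    rowCoeff Q t (d + 1) (betweenCount v i l a b +
        if (a < x ∧ x < b) ∨ (b < x ∧ x < a) then 1 else 0) a b +
      swapCoeff Q t d (betweenCount v i l a x) a x *
        rowCoeff Q t (d + 1) (betweenCount v i l x b +
          if (x < a ∧ a < b) ∨ (b < a ∧ a < x) then 1 else 0) x b =
      rowCoeff Q t d (betweenCount v i l a b) a b := by
  have h1 := hQ d hd
  have h2 := hQ (d + 1) (by omega)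
  rw [pow_succ, ← mul_assoc] at h2
  have hA : Q * t ^ (d + 1) = Q * t ^ d * t := by rw [pow_succ, mul_assoc]
  -- The cyclic order of `a, x, b` decides which identity applies: `a < x < b` and its rotations use
  -- the first, the other three orders the second. The equations `he`, `he1`, `he2` only align
  -- exponents of `t`.
  rcases lt_or_gt_of_ne hab with cab | cab
  · rcases lt_or_gt_of_ne hax with cax | cax
    · rcases lt_or_gt_of_ne hxb with cxb | cxb
      · rw [rowCoeff_of_lt _ _ _ _ cab, rowCoeff_of_lt _ _ _ _ cxb, rowCoeff_of_lt _ _ _ _ cab,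
          swapCoeff, if_pos cax, if_pos (Or.inl ⟨cax, cxb⟩),
          if_neg (by omega), betweenCount_add v cax cxb hx, hA]
        have hcore := rowCoeff_step_of_asc
          (Z := t ^ (betweenCount v i l a x : ℤ) * t ^ (betweenCount v i l x b : ℤ)) h1 h2
        push_cast
        simp only [zpow_add₀ ht, zpow_one, add_zero]
        linear_combination hcore
      · rw [rowCoeff_of_lt _ _ _ _ cab, rowCoeff_of_gt _ _ _ _ cxb, rowCoeff_of_lt _ _ _ _ cab,
          swapCoeff, if_pos cax, if_neg (by omega), if_neg (by omega),
          betweenCount_add v cab cxb hb, betweenCount_comm v i l x b, hA, add_zero]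
        have hcore := rowCoeff_step_of_desc (Z := t ^ (betweenCount v i l a b : ℤ)) h1 h2
        have he : t ^ ((betweenCount v i l a b + betweenCount v i l b x : ℕ) : ℤ) *
            t ^ (((d + 1 : ℕ) : ℤ) - 1 - (betweenCount v i l b x + 0 : ℕ)) =
            t ^ (betweenCount v i l a b : ℤ) * t ^ d := by
          rw [← zpow_natCast t d, ← zpow_add₀ ht, ← zpow_add₀ ht]
          congr 1
          push_cast
          ring
        linear_combination hcore +
          ((1 - t) / (1 - Q * t ^ d)) * Q * ((1 - t) / (1 - Q * t ^ d * t)) * he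
    · have cxb : x < b := cax.trans cab
      rw [rowCoeff_of_lt _ _ _ _ cab, rowCoeff_of_lt _ _ _ _ cxb, rowCoeff_of_lt _ _ _ _ cab,
        swapCoeff, if_neg cax.not_gt, if_neg (by omega), if_pos (Or.inl ⟨cax, cab⟩),
        betweenCount_add v cax cab ha, betweenCount_comm v i l a x, hA, add_zero]
      have hcore := rowCoeff_step_of_desc (Z := t ^ (betweenCount v i l a b : ℤ)) h1 h2
      have he : t ^ (-1 - (betweenCount v i l x a : ℤ)) *
          t ^ ((betweenCount v i l x a + betweenCount v i l a b + 1 : ℕ) : ℤ) =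
          t ^ (betweenCount v i l a b : ℤ) := by
        rw [← zpow_add₀ ht]
        congr 1
        push_cast
        ring
      linear_combination hcore + ((1 - t) / (1 - Q * t ^ d)) * (Q * t ^ d) *
        ((1 - t) / (1 - Q * t ^ d * t)) * he
  · rcases lt_or_gt_of_ne hax with cax | cax
    · have cbx : b < x := cab.trans cax
      rw [rowCoeff_of_gt _ _ _ _ cab, rowCoeff_of_gt _ _ _ _ cbx, rowCoeff_of_gt _ _ _ _ cab,
        swapCoeff, if_pos cax, if_neg (by omega), if_pos (Or.inr ⟨cab, cax⟩),
        betweenCount_comm v i l x b, betweenCount_comm v i l a b,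
        betweenCount_add v cab cax ha, hA, add_zero]
      have hcore := rowCoeff_step_of_asc (Z := t ^ ((d : ℤ) - 1 - betweenCount v i l b a) * Q) h1 h2
      have he1 : t ^ (((d + 1 : ℕ) : ℤ) - 1 - (betweenCount v i l b a : ℤ)) =
          t ^ ((d : ℤ) - 1 - betweenCount v i l b a) * t := by
        rw [← zpow_add_one₀ ht]
        congr 1
        push_cast
        ring
      have he2 : t ^ (betweenCount v i l a x : ℤ) *
          t ^ (((d + 1 : ℕ) : ℤ) - 1 -
            (betweenCount v i l b a + betweenCount v i l a x + 1 : ℕ)) =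
          t ^ ((d : ℤ) - 1 - betweenCount v i l b a) := by
        rw [← zpow_add₀ ht]
        congr 1
        push_cast
        ring
      linear_combination hcore + Q * ((1 - t) / (1 - Q * t ^ d * t)) * he1 +
        ((1 - t) / (1 - Q * t ^ d)) * Q * ((1 - t) / (1 - Q * t ^ d * t)) * he2
    · rcases lt_or_gt_of_ne hxb with cxb | cxb
      · rw [rowCoeff_of_gt _ _ _ _ cab, rowCoeff_of_lt _ _ _ _ cxb, rowCoeff_of_gt _ _ _ _ cab,
          swapCoeff, if_neg cax.not_gt, if_neg (by omega), if_neg (by omega),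
          betweenCount_comm v i l a x, betweenCount_comm v i l a b,
          betweenCount_add v cxb cab hb, hA, add_zero]
        have hcore := rowCoeff_step_of_asc
          (Z := t ^ ((d : ℤ) - 1 - betweenCount v i l b a) * Q) h1 h2
        have he1 : t ^ (((d + 1 : ℕ) : ℤ) - 1 - (betweenCount v i l b a : ℤ)) =
            t ^ ((d : ℤ) - 1 - betweenCount v i l b a) * t := by
          rw [← zpow_add_one₀ ht]
          congr 1
          push_cast
          ring
        have he2 : t ^ (-1 - ((betweenCount v i l x b + betweenCount v i l b a : ℕ) : ℤ)) *
            t ^ d * t ^ ((betweenCount v i l x b + 0 : ℕ) : ℤ) =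
            t ^ ((d : ℤ) - 1 - betweenCount v i l b a) := by
          rw [← zpow_natCast t d, ← zpow_add₀ ht, ← zpow_add₀ ht]
          congr 1
          push_cast
          ring
        linear_combination hcore + Q * ((1 - t) / (1 - Q * t ^ d * t)) * he1 +
          ((1 - t) / (1 - Q * t ^ d)) * Q * ((1 - t) / (1 - Q * t ^ d * t)) * he2
      · rw [rowCoeff_of_gt _ _ _ _ cab, rowCoeff_of_gt _ _ _ _ cxb, rowCoeff_of_gt _ _ _ _ cab,
          swapCoeff, if_neg cax.not_gt, if_pos (Or.inr ⟨cxb, cax⟩), if_neg (by omega),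
          betweenCount_comm v i l a x, betweenCount_comm v i l a b, betweenCount_comm v i l x b,
          betweenCount_add v cxb cax hx, hA, add_zero]
        have hcore := rowCoeff_step_of_desc
          (Z := t ^ ((d : ℤ) - 1 - (betweenCount v i l b x + betweenCount v i l x a : ℕ)) * Q) h1 h2
        have he1 : t ^ (((d + 1 : ℕ) : ℤ) - 1 -
            (betweenCount v i l b x + betweenCount v i l x a + 1 : ℕ)) =
            t ^ ((d : ℤ) - 1 - (betweenCount v i l b x + betweenCount v i l x a : ℕ)) := by
          congr 1
          push_cast
          ring
        have he2 : t ^ (-1 - (betweenCount v i l x a : ℤ)) *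
            t ^ (((d + 1 : ℕ) : ℤ) - 1 - (betweenCount v i l b x + 0 : ℕ)) =
            t ^ ((d : ℤ) - 1 - (betweenCount v i l b x + betweenCount v i l x a : ℕ)) := by
          rw [← zpow_add₀ ht]
          congr 1
          push_cast
          ring
        linear_combination hcore + Q * ((1 - t) / (1 - Q * t ^ d * t)) * he1 +
          Q * t ^ d * ((1 - t) / (1 - Q * t ^ d)) * Q * ((1 - t) / (1 - Q * t ^ d * t)) * he2

theorem filter_finRange_reverse_eq_append {P P' : Fin n → Prop} [DecidablePred P]
    [DecidablePred P'] (k : Fin n) (hP : ∀ m, P m ↔ P' m ∨ m = k) (hk : ∀ m, P' m → k < m) :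
    (List.finRange n).reverse.filter (fun m => P m) =
      (List.finRange n).reverse.filter (fun m => P' m) ++ [k] := by
  have hs := pairwise_finRange_reverse n
  refine (hs.filter _).eq_of_mem_iff (r := fun a b => b < a) ?_ ?_
  · rw [List.pairwise_append]
    refine ⟨hs.filter _, by simp, ?_⟩
    intro a ha b hb
    simp at ha hb
    subst hb
    exact hk a ha
  · intro a
    simp [hP]

theorem stepCoeff_eq_swapCoeff (q t : K) (j : ℕ) {i l : Fin n} (v : Equiv.Perm (Fin n)) :
    stepCoeff lam q t ⟨j, i, l⟩ v = swapCoeff (q ^ arm lam (i, j - 1)) t (l.val - i.val)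
      (betweenCount v i l (v i) (v l)) (v i) (v l) := by
  simp only [stepCoeff, swapCoeff, stepExponent, entryFactor]
  split_ifs <;> ring

/-- The sum over all choices of foldings in positions `(i, l)`, `l ≥ l₀`, of row `i`. -/
theorem foldl_row {q t : K} (ht : t ≠ 0) (j : ℕ) (i : Fin n)
    (hQ : ∀ d : ℕ, 1 ≤ d → 1 - q ^ arm lam (i, j - 1) * t ^ d ≠ 0)
    (F : Equiv.Perm (Fin n) → K) (C : K) (b : Fin n) (r : ℕ) (hir : i.val < r)
    (v₀ : Equiv.Perm (Fin n))
    (hF : ∀ v : Equiv.Perm (Fin n), (∀ m : Fin n, m.val < r → m ≠ i → v m = v₀ m) →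
      F v = if v i = b then C else 0)
    (l₀ : ℕ) (hr : r ≤ l₀) (hn : l₀ ≤ n) (v : Equiv.Perm (Fin n))
    (hv : ∀ m : Fin n, m.val < r → m ≠ i → v m = v₀ m) :
    (((List.finRange n).reverse.filter fun h => l₀ ≤ h.val).map
        fun h => (⟨j, i, h⟩ : Entry n)).foldl (foldStep lam q t) F v =
      C * if v i = b ∨ ∃ m : Fin n, l₀ ≤ m.val ∧ v m = b then
        rowCoeff (q ^ arm lam (i, j - 1)) t (l₀ - i.val) (betweenCount v i l₀ (v i) b) (v i) b
      else 0 := by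
  classical
  induction hn using Nat.decreasingInduction generalizing v with
  | self =>
    have hnil : ((List.finRange n).reverse.filter fun h => n ≤ h.val) = [] := by
      rw [List.filter_eq_nil_iff]
      intro m _
      simp
    have hno : ¬ ∃ m : Fin n, n ≤ m.val ∧ v m = b := by
      rintro ⟨m, hm, -⟩
      exact absurd m.isLt (not_lt.mpr hm)
    rw [hnil, List.map_nil, List.foldl_nil, hF v hv]
    by_cases hvb : v i = b
    · rw [if_pos hvb, if_pos (Or.inl hvb), hvb, rowCoeff_self, mul_one]
    · rw [if_neg hvb, if_neg (not_or.mpr ⟨hvb, hno⟩), mul_zero]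
  | of_succ k hk ih =>
    set l : Fin n := ⟨k, hk⟩ with hl
    have hil : i < l := Fin.lt_def.mpr (lt_of_lt_of_le hir hr)
    have hsplit := filter_finRange_reverse_eq_append (n := n) (P := fun m => k ≤ m.val)
      (P' := fun m => k + 1 ≤ m.val) l
      (fun m => by simp only [hl, Fin.ext_iff]; omega)
      (fun m hm => by simp only [hl, Fin.lt_def]; omega)
    rw [hsplit, List.map_append, List.foldl_append, List.map_singleton, List.foldl_cons,
      List.foldl_nil, foldStep]
    set v' := v * entrySwap (⟨j, i, l⟩ : Entry n) with hv'
    have hv'i : v' i = v l := by simp [hv', entrySwap]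
    have hv'l : v' l = v i := by simp [hv', entrySwap]
    have hv'm : ∀ m, m ≠ i → m ≠ l → v' m = v m := by
      intro m h1 h2
      simp [hv', entrySwap, Equiv.swap_apply_of_ne_of_ne h1 h2]
    have hagree : ∀ m : Fin n, m.val < r → m ≠ i → v' m = v₀ m := by
      intro m h1 h2
      rw [hv'm m h2 (fun h => by rw [h] at h1; simp only [hl] at h1; omega), hv m h1 h2]
    rw [ih (by omega) v hv, ih (by omega) v' hagree, stepCoeff_eq_swapCoeff, hv'i]
    have hd : k + 1 - i.val = (k - i.val) + 1 := by
      have : i.val < k := hil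
      omega
    have hd1 : 1 ≤ k - i.val := by
      have : i.val < k := hil
      omega
    have hne : v i ≠ v l := fun h => hil.ne (v.injective h)
    have hex : (∃ m : Fin n, k ≤ m.val ∧ v m = b) ↔
        v l = b ∨ ∃ m : Fin n, k + 1 ≤ m.val ∧ v m = b := by
      constructor
      · rintro ⟨m, hm, hmb⟩
        rcases hm.eq_or_lt with hm | hm
        · exact Or.inl (by rw [← hmb]; congr 1; exact Fin.ext hm)
        · exact Or.inr ⟨m, hm, hmb⟩
      · rintro (h | ⟨m, hm, hmb⟩)
        · exact ⟨l, le_rfl, h⟩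
        · exact ⟨m, by omega, hmb⟩
    have hex' : (∃ m : Fin n, k + 1 ≤ m.val ∧ v' m = b) ↔
        ∃ m : Fin n, k + 1 ≤ m.val ∧ v m = b := by
      refine exists_congr fun m => and_congr_right fun hm => ?_
      have hil' : i.val < k := hil
      rw [hv'm m (fun h => by rw [h] at hm; omega)
        (fun h => by rw [h] at hm; simp only [hl] at hm; omega)]
    simp only [hex']
    -- If `b` is already in row `i`, a folding would move it to position `l`, from which no earlier
    -- folding of this row can recover it; only the unfolded term survives.
    by_cases hib : v i = b
    · have h1 : v l ≠ b := fun h => hne (hib.trans h.symm)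
      have h2 : ¬ ∃ m : Fin n, k + 1 ≤ m.val ∧ v m = b := by
        rintro ⟨m, hm, hmb⟩
        have hmi := v.injective (hmb.trans hib.symm)
        have hil' : i.val < k := hil
        rw [hmi] at hm
        omega
      rw [if_pos (Or.inl hib), if_neg (not_or.mpr ⟨h1, h2⟩), if_pos (Or.inl hib), hib,
        rowCoeff_self, rowCoeff_self]
      ring
    -- If `b` is at position `l`, the unfolded term vanishes and the folding at `l` is forced.
    · by_cases hlb : v l = b
      · have h2 : ¬ ∃ m : Fin n, k + 1 ≤ m.val ∧ v m = b := by
          rintro ⟨m, hm, hmb⟩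
          have hml := v.injective (hmb.trans hlb.symm)
          rw [hml] at hm
          simp only [hl] at hm
          omega
        rw [if_neg (not_or.mpr ⟨hib, h2⟩), if_pos (Or.inl hlb),
          if_pos (Or.inr (hex.mpr (Or.inl hlb))), hlb, rowCoeff_self, swapCoeff_eq_rowCoeff ht _ _ hib]
        ring
      · by_cases hx : ∃ m : Fin n, k + 1 ≤ m.val ∧ v m = b
        · rw [if_pos (Or.inr hx), if_pos (Or.inr hx), if_pos (Or.inr (hex.mpr (Or.inr hx)))]
          -- The three values involved are at `i` or at positions from `k` on, so by injectivity
          -- none occurs strictly between `i` and `k`, as `rowCoeff_step` requires.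
          have hpos : ∀ (m₀ m : Fin n), (m₀ = i ∨ k ≤ m₀.val) → i < m → m.val < k →
              v m ≠ v m₀ := by
            intro m₀ m h0 h1 h2 h3
            have := v.injective h3
            subst this
            rcases h0 with h0 | h0
            · exact h1.ne' h0
            · omega
          obtain ⟨mb, hmb, hmb'⟩ := hx
          have key := rowCoeff_step (Q := q ^ arm lam (i, j - 1)) ht hQ hd1 v i k hib hlb hne
            (fun m => hpos i m (Or.inl rfl)) (fun m => hpos l m (Or.inr le_rfl))
            (fun m h1 h2 => hmb' ▸ hpos mb m (Or.inr (by omega)) h1 h2)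
          have e1 := betweenCount_succ v hil (v i) b
          have e2 := betweenCount_succ v' hil (v l) b
          have e3 : betweenCount v' i l (v l) b = betweenCount v i l (v l) b :=
            betweenCount_congr fun m h1 h2 => hv'm m h1.ne' (ne_of_lt h2)
          rw [hv'l, e3] at e2
          simp only [hl] at e1 e2 key ⊢
          rw [hd, e1, e2, ← key]
          ring
        · rw [if_neg (not_or.mpr ⟨hib, hx⟩), if_neg (not_or.mpr ⟨hlb, hx⟩),
            if_neg (not_or.mpr ⟨hib, fun hk => (hex.mp hk).elim hlb hx⟩)]
          ring

/-! ### Summation over one segment -/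

/-- The sum over all choices of foldings in the rows `i ≥ i₀` of a segment. Here `a` and `b` are two
consecutive columns, of heights `r` and `k`. -/
theorem foldl_rows {q t : K} (ht : t ≠ 0) (j k r : ℕ) (hkr : k ≤ r) (hrn : r ≤ n)
    (hQ : ∀ i : Fin n, i.val < k → ∀ d : ℕ, 1 ≤ d → 1 - q ^ arm lam (i, j - 1) * t ^ d ≠ 0)
    (a b : Fin n → Fin n) (hb : ∀ m m' : Fin n, m.val < k → m'.val < k → b m = b m' → m = m')
    (hab : ∀ i m : Fin n, i.val < k → i < m → m.val < r → a m ≠ b i)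
    (F : Equiv.Perm (Fin n) → K) (C : K)
    (hF : ∀ v : Equiv.Perm (Fin n), F v =
      if ∀ m : Fin n, m.val < k → v m = b m then C else 0)
    (i₀ : ℕ) (hi₀ : i₀ ≤ k) (v : Equiv.Perm (Fin n))
    (hv : ∀ m : Fin n, i₀ ≤ m.val → m.val < r → v m = a m) :
    ((((List.finRange n).reverse.filter fun i => i₀ ≤ i.val ∧ i.val < k).flatMap fun i =>
      ((List.finRange n).reverse.filter fun h => r ≤ h.val).map fun h => (i, h)).map
        fun β => (⟨j, β.1, β.2⟩ : Entry n)).foldl (foldStep lam q t) F v =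
      if ∀ m : Fin n, m.val < i₀ → v m = b m then
        C * ∏ i ∈ Finset.univ.filter (fun i : Fin n => i₀ ≤ i.val ∧ i.val < k),
          rowCoeff (q ^ arm lam (i, j - 1)) t (r - i.val) (betweenCount a i r (a i) (b i))
            (a i) (b i)
      else 0 := by
  classical
  induction hi₀ using Nat.decreasingInduction generalizing v with
  | self =>
    have hnil : ((List.finRange n).reverse.filter fun i => k ≤ i.val ∧ i.val < k) = [] := by
      rw [List.filter_eq_nil_iff]
      intro m _
      simp only [decide_eq_true_eq]
      omega
    have hempty : (Finset.univ.filter fun i : Fin n => k ≤ i.val ∧ i.val < k) = ∅ := by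
      rw [Finset.filter_eq_empty_iff]
      intro m _
      omega
    rw [hnil, List.flatMap_nil, List.map_nil, List.foldl_nil, hF, hempty, Finset.prod_empty,
      mul_one]
  | of_succ k' hk' ih =>
    set i : Fin n := ⟨k', by omega⟩ with hi
    have hsplit := filter_finRange_reverse_eq_append (n := n) (P := fun m => k' ≤ m.val ∧ m.val < k)
      (P' := fun m => k' + 1 ≤ m.val ∧ m.val < k) i
      (fun m => by simp only [hi, Fin.ext_iff]; omega)
      (fun m hm => by simp only [hi, Fin.lt_def]; omega)
    have hprod : (Finset.univ.filter fun m : Fin n => k' ≤ m.val ∧ m.val < k) =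
        insert i (Finset.univ.filter fun m : Fin n => k' + 1 ≤ m.val ∧ m.val < k) := by
      ext m
      simp only [hi, Finset.mem_filter, Finset.mem_univ, true_and, Finset.mem_insert, Fin.ext_iff]
      omega
    rw [hprod, Finset.prod_insert (by simp [hi]), hsplit, List.flatMap_append, List.map_append,
      List.foldl_append, List.flatMap_singleton, List.map_map]
    set P := ∏ i ∈ Finset.univ.filter (fun i : Fin n => k' + 1 ≤ i.val ∧ i.val < k),
      rowCoeff (q ^ arm lam (i, j - 1)) t (r - i.val) (betweenCount a i r (a i) (b i))
        (a i) (b i) with hP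
    -- Row `i` comes last among the rows considered and so acts outermost. The sum over the
    -- later-indexed rows serves as its `F`: it sees foldings of row `i` only through the value at
    -- `i`.
    have hrow := foldl_row (lam := lam) (q := q) ht j i (hQ i hk')
      _ (if ∀ m : Fin n, m.val < k' → v m = b m then C * P else 0) (b i) r
      (by simp only [hi]; omega) v
      (fun v' hv' => (ih v' (fun m h1 h2 => by
        rw [hv' m h2 (fun h => by rw [h] at h1; simp only [hi] at h1; omega),
          hv m (by omega) h2])).trans (by
        have hiff : (∀ m : Fin n, m.val < k' + 1 → v' m = b m) ↔
            (∀ m : Fin n, m.val < k' → v m = b m) ∧ v' i = b i := by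
          constructor
          · intro h
            refine ⟨fun m hm => ?_, h i (by simp [hi])⟩
            rw [← h m (by omega), hv' m (by omega) (fun h => by rw [h] at hm; simp [hi] at hm)]
          · rintro ⟨h1, h2⟩ m hm
            rcases Nat.lt_succ_iff_lt_or_eq.mp hm with hm | hm
            · rw [hv' m (by omega) (fun h => by rw [h] at hm; simp [hi] at hm), h1 m hm]
            · rw [show m = i from Fin.ext hm, h2]
        by_cases h1 : v' i = b i
        · simp only [hiff, h1, and_true, if_true]
        · simp only [hiff, h1, and_false, if_false])) r le_rfl hrn v (fun m _ _ => rfl)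
    refine hrow.trans ?_
    have hvi : v i = a i := hv i le_rfl (by simp only [hi]; omega)
    by_cases hmatch : ∀ m : Fin n, m.val < k' → v m = b m
    -- The value `b i` occurs somewhere in `v`. Positions before `i` carry other entries of column
    -- `b`, and positions between `i` and `r` are excluded by the nonattacking hypothesis `hab`.
    · have hfound : v i = b i ∨ ∃ m : Fin n, r ≤ m.val ∧ v m = b i := by
        obtain ⟨m, hm⟩ := v.surjective (b i)
        rcases lt_trichotomy m i with h | h | h
        · have := hmatch m h
          have h2 := hb m i (lt_trans h hk') hk' (this.symm.trans hm)
          exact absurd h2 h.ne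
        · rw [← h]
          exact Or.inl (h ▸ hm)
        · refine Or.inr ⟨m, ?_, hm⟩
          by_contra hlt
          have hmr : m.val < r := not_le.mp hlt
          have hkm : k' ≤ m.val := le_of_lt h
          exact hab i m hk' h hmr ((hv m hkm hmr).symm.trans hm)
      have hbc : betweenCount v i r (v i) (b i) = betweenCount a i r (v i) (b i) :=
        betweenCount_congr fun m h1 h2 => hv m (le_of_lt h1) h2
      rw [if_pos hmatch, if_pos hfound, if_pos hmatch, hbc, hvi]
      ring
    · rw [if_neg hmatch, if_neg hmatch, zero_mul]

/-! ### Summation over all columns -/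

/-- Column `j` of a filling, extended by arbitrary values outside the diagram. -/
def column (σ : Filling lam) (j : ℕ) (i : Fin n) : Fin n :=
  if h : (i, j) ∈ diagram lam then σ ⟨(i, j), h⟩ else i

theorem column_apply (σ : Filling lam) (u : {u : Fin n × ℕ // u ∈ diagram lam}) :
    column σ u.1.2 u.1.1 = σ u := by
  have : (u.1.1, u.1.2) ∈ diagram lam := u.2
  rw [column, dif_pos this]

theorem colMatch_iff (h : StrictAnti lam) (σ : Filling lam) {j : ℕ} (hj : 1 ≤ j)
    (v : Equiv.Perm (Fin n)) :
    ColMatch σ j v ↔ ∀ m : Fin n, m.val < conj lam j → v m = column σ j m := by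
  constructor
  · intro hC m hm
    rw [lt_conj_iff h] at hm
    have hmem : (m, j) ∈ diagram lam := mem_diagram.mpr ⟨hj, hm⟩
    rw [column, dif_pos hmem]
    exact hC ⟨(m, j), hmem⟩ rfl
  · intro hm u hu
    have hmem := mem_diagram.mp u.2
    rw [← column_apply σ u, hu]
    exact hm _ ((lt_conj_iff h).mpr (hu ▸ hmem.2))

/-- The contribution of the foldings that relate row `i` of columns `j` and `j + 1`. -/
noncomputable def cellCoeff (q t : K) (σ : Filling lam) (i : Fin n) (j : ℕ) : K :=
  rowCoeff (q ^ arm lam (i, j)) t (conj lam j - i.val)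
    (betweenCount (column σ j) i (conj lam j) (column σ j i) (column σ (j + 1) i))
    (column σ j i) (column σ (j + 1) i)

theorem colSum_of_numCols_le (q t : K) (σ : Filling lam) {j : ℕ} (hj : numCols lam ≤ j)
    (v : Equiv.Perm (Fin n)) [Decidable (ColMatch σ j v)] :
    colSum q t σ j v = if ColMatch σ j v then 1 else 0 := by
  classical
  have : MatchesFrom σ j v [] ↔ ColMatch σ j v := by
    constructor
    · intro hM u hu
      simpa using hM u hu.ge
    · intro hC u hu
      have h1 := (mem_diagram.mp u.2).2
      have h2 := le_numCols lam u.1.1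
      simpa using hC u (by omega)
  have hnil : chainAbove lam j = [] := by simp [chainAbove, Nat.sub_eq_zero_of_le hj]
  simp [colSum, hnil, subSum, walkCoeff, this]

theorem one_sub_ne_zero {q t : K} (hqt : ∀ a b : ℕ, 1 ≤ a → 1 ≤ b → q ^ a * t ^ b ≠ 1)
    {a b : ℕ} (ha : 1 ≤ a) (hb : 1 ≤ b) : 1 - q ^ a * t ^ b ≠ 0 :=
  sub_ne_zero.mpr (hqt a b ha hb).symm

-- The row sums depend on `v` only through column `j`, so each transfer step returns a constant
-- multiple of the indicator of a matching column, and the induction closes.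
open Classical in
theorem colSum_eq_prod (h : StrictAnti lam) {q t : K} (ht : t ≠ 0)
    (hqt : ∀ a b : ℕ, 1 ≤ a → 1 ≤ b → q ^ a * t ^ b ≠ 1)
    (σ : Filling lam) (hσ : Nonattacking σ) {j : ℕ} (hj : 1 ≤ j) (hjN : j ≤ numCols lam)
    (v : Equiv.Perm (Fin n)) :
    colSum q t σ j v = if ColMatch σ j v then
      ∏ j' ∈ Finset.Ico j (numCols lam),
        ∏ i ∈ Finset.univ.filter (fun i : Fin n => j' + 1 ≤ lam i), cellCoeff q t σ i j'
      else 0 := by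
  induction hjN using Nat.decreasingInduction generalizing v with
  | self =>
    rw [colSum_of_numCols_le q t σ le_rfl, Finset.Ico_self, Finset.prod_empty]
  | of_succ k hk ih =>
    rw [colSum_eq q t σ hk, Finset.prod_eq_prod_Ico_succ_bot hk]
    by_cases hC : ColMatch σ k v
    · rw [if_pos hC, if_pos hC, one_mul, segment_eq h (by omega), rootRows]
      -- Both kinds of attack enter here: distinct cells of column `k + 1` give the injectivity of
      -- `b`, and the pairs `(m, k)`, `(i, k + 1)` with `i < m` give `hab`. The arm of a cell with a
      -- left neighbour is at least `1`, so the denominators do not vanish.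
      have hrows := foldl_rows (lam := lam) (q := q) ht (k + 1) (conj lam (k + 1)) (conj lam k)
        (conj_anti lam (Nat.le_succ k)) (conj_le lam k)
        (fun i hi d hd => one_sub_ne_zero hqt (by
          rw [lt_conj_iff h] at hi
          rw [arm_eq]
          omega) hd)
        (column σ k) (column σ (k + 1))
        (fun m m' hm hm' heq => by
          rw [lt_conj_iff h] at hm hm'
          have h1 : (m, k + 1) ∈ diagram lam := mem_diagram.mpr ⟨by simp, hm⟩
          have h2 : (m', k + 1) ∈ diagram lam := mem_diagram.mpr ⟨by simp, hm'⟩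
          by_contra hne
          rw [column, column, dif_pos h1, dif_pos h2] at heq
          exact hσ ⟨_, h1⟩ ⟨_, h2⟩ (Or.inl ⟨rfl, hne⟩) heq)
        (fun i m hi him hm heq => by
          rw [lt_conj_iff h] at hi hm
          have h1 : (m, k) ∈ diagram lam := mem_diagram.mpr ⟨hj, hm⟩
          have h2 : (i, k + 1) ∈ diagram lam := mem_diagram.mpr ⟨by simp, hi⟩
          rw [column, column, dif_pos h1, dif_pos h2] at heq
          exact hσ ⟨_, h1⟩ ⟨_, h2⟩ (Or.inr (Or.inr ⟨rfl, him⟩)) heq)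
        (colSum q t σ (k + 1)) (∏ j' ∈ Finset.Ico (k + 1) (numCols lam),
          ∏ i ∈ Finset.univ.filter (fun i : Fin n => j' + 1 ≤ lam i), cellCoeff q t σ i j')
        (fun v' => by
          rw [ih (by omega) v']
          simp only [colMatch_iff h σ (by omega : 1 ≤ k + 1)])
        0 (Nat.zero_le _) v (fun m _ hm => (colMatch_iff h σ hj v).mp hC m hm)
      simp only [Nat.zero_le, true_and, Nat.not_lt_zero, false_imp_iff, implies_true, if_true,
        lt_conj_iff h] at hrows
      simp only [lt_conj_iff h]
      refine hrows.trans ?_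
      rw [mul_comm]
      rfl
    · rw [if_neg hC, if_neg hC, zero_mul]

/-! ### The first column -/

/-- Strictness makes every row but possibly the last nonempty, so the first column prescribes at
least `n - 1` distinct values of the permutation. -/
theorem existsUnique_colMatch_one (h : StrictAnti lam) (σ : Filling lam) (hσ : Nonattacking σ) :
    ∃! v : Equiv.Perm (Fin n), ColMatch σ 1 v := by
  classical
  have hinj : Function.Injective (fun m : {m : Fin n // 1 ≤ lam m} => column σ 1 m.1) := by
    intro m m' heq
    by_contra hne
    have h1 : (m.1, 1) ∈ diagram lam := mem_diagram.mpr ⟨le_rfl, m.2⟩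
    have h2 : (m'.1, 1) ∈ diagram lam := mem_diagram.mpr ⟨le_rfl, m'.2⟩
    simp only [column, dif_pos h1, dif_pos h2] at heq
    exact hσ ⟨_, h1⟩ ⟨_, h2⟩ (Or.inl ⟨rfl, fun hc => hne (Subtype.ext hc)⟩) heq
  let e := Equiv.ofInjective _ hinj
  refine ⟨e.extendSubtype, ?_, ?_⟩
  · simp only [colMatch_iff h σ le_rfl, lt_conj_iff h]
    intro m hm
    rw [Equiv.extendSubtype_apply_of_mem e m hm]
    rfl
  · intro v hv
    simp only [colMatch_iff h σ le_rfl, lt_conj_iff h] at hv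
    set v' := e.extendSubtype with hv'
    have hagree : ∀ m : Fin n, m.val + 1 < n → v m = v' m := by
      intro m hm
      have hpos := pos_of_succ_lt h hm
      rw [hv m hpos, hv', Equiv.extendSubtype_apply_of_mem e m hpos]
      rfl
    ext1 m
    by_cases hm : m.val + 1 < n
    · exact hagree m hm
    -- Two permutations that agree off the last position also agree there.
    · obtain ⟨y, hy⟩ := v'.surjective (v m)
      by_cases hyn : y.val + 1 < n
      · rw [← hagree y hyn] at hy
        have := v.injective hy
        subst this
        exact absurd hyn hm
      · have : y = m := Fin.ext (by have := y.isLt; have := m.isLt; omega)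
        rw [← hy, this]

theorem sum_fibre_eq_prod (h : StrictAnti lam) {q t : K} (ht : t ≠ 0)
    (hqt : ∀ a b : ℕ, 1 ≤ a → 1 ≤ b → q ^ a * t ^ b ≠ 1)
    (σ : Filling lam) (hσ : Nonattacking σ) :
    ∑ P ∈ fibre σ, weight q t P.1 P.2 = ∏ j ∈ Finset.Ico 1 (numCols lam),
      ∏ i ∈ Finset.univ.filter (fun i : Fin n => j + 1 ≤ lam i), cellCoeff q t σ i j := by
  classical
  have hcol : ∀ v, colSum q t σ 1 v = if ColMatch σ 1 v then ∏ j ∈ Finset.Ico 1 (numCols lam),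
      ∏ i ∈ Finset.univ.filter (fun i : Fin n => j + 1 ≤ lam i), cellCoeff q t σ i j else 0 := by
    intro v
    rcases Nat.eq_zero_or_pos (numCols lam) with hN | hN
    · rw [colSum_of_numCols_le q t σ (by omega), hN]
      simp
    · exact colSum_eq_prod h ht hqt σ hσ le_rfl hN v
  obtain ⟨v₀, hv₀, huniq⟩ := existsUnique_colMatch_one h σ hσ
  rw [sum_fibre_eq h q t ht, Finset.sum_eq_single v₀]
  · rw [hcol, if_pos hv₀]
  · intro v _ hv
    rw [hcol, if_neg fun hc => hv (huniq v hc)]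
  · simp

/-! ### Comparison with the statistics of the filling -/

/-- The cells `(i, j)` of the diagram for which `(i, j + 1)` is in the diagram too. -/
def innerCells (lam : Fin n → ℕ) : Finset (Fin n × ℕ) :=
  (diagram lam).filter fun u => u.2 + 1 ≤ lam u.1

theorem mem_innerCells {u : Fin n × ℕ} : u ∈ innerCells lam ↔ 1 ≤ u.2 ∧ u.2 + 1 ≤ lam u.1 := by
  simp only [innerCells, Finset.mem_filter, mem_diagram]
  omega

theorem prod_innerCells (lam : Fin n → ℕ) {M : Type*} [CommMonoid M] (G : Fin n → ℕ → M) :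
    ∏ j ∈ Finset.Ico 1 (numCols lam),
      ∏ i ∈ Finset.univ.filter (fun i : Fin n => j + 1 ≤ lam i), G i j =
      ∏ u ∈ innerCells lam, G u.1 u.2 := by
  have hset : innerCells lam = (Finset.univ ×ˢ Finset.Ico 1 (numCols lam)).filter
      fun u => u.2 + 1 ≤ lam u.1 := by
    ext u
    have := le_numCols lam u.1
    simp only [mem_innerCells, Finset.mem_filter, Finset.mem_product, Finset.mem_univ, true_and,
      Finset.mem_Ico]
    omega
  rw [hset, Finset.prod_filter, Finset.prod_product_right]
  simp only [Finset.prod_filter]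

theorem map_Des (σ : Filling lam) : (Des σ).map (Function.Embedding.subtype _) =
    (innerCells lam).filter fun u => column σ (u.2 + 1) u.1 < column σ u.2 u.1 := by
  ext u
  simp only [Des, Finset.mem_map, Finset.mem_filter, Finset.mem_univ, true_and,
    Function.Embedding.subtype_apply, mem_innerCells]
  constructor
  · rintro ⟨u', ⟨v, hv, hlt⟩, rfl⟩
    have h1 := mem_diagram.mp u'.2
    have h2 := mem_diagram.mp v.2
    have h3 := column_apply σ v
    rw [hv] at h2 h3
    refine ⟨⟨h1.1, h2.2⟩, ?_⟩
    rw [column_apply]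
    exact h3.symm ▸ hlt
  · rintro ⟨⟨h1, h2⟩, hlt⟩
    have hu : u ∈ diagram lam := mem_diagram.mpr ⟨h1, by omega⟩
    have hv : (u.1, u.2 + 1) ∈ diagram lam := mem_diagram.mpr ⟨by simp, h2⟩
    refine ⟨⟨u, hu⟩, ⟨⟨_, hv⟩, rfl, ?_⟩, rfl⟩
    rw [← column_apply σ ⟨u, hu⟩, ← column_apply σ ⟨_, hv⟩]
    exact hlt

theorem map_Diff (σ : Filling lam) : (Diff σ).map (Function.Embedding.subtype _) =
    (innerCells lam).filter fun u => column σ u.2 u.1 ≠ column σ (u.2 + 1) u.1 := by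
  ext u
  simp only [Diff, Finset.mem_map, Finset.mem_filter, Finset.mem_univ, true_and,
    Function.Embedding.subtype_apply, mem_innerCells]
  constructor
  · rintro ⟨u', ⟨v, hv, hlt⟩, rfl⟩
    have h1 := mem_diagram.mp u'.2
    have h2 := mem_diagram.mp v.2
    have h3 := column_apply σ v
    rw [hv] at h2 h3
    refine ⟨⟨h1.1, h2.2⟩, ?_⟩
    rw [column_apply]
    exact h3.symm ▸ hlt
  · rintro ⟨⟨h1, h2⟩, hlt⟩
    have hu : u ∈ diagram lam := mem_diagram.mpr ⟨h1, by omega⟩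
    have hv : (u.1, u.2 + 1) ∈ diagram lam := mem_diagram.mpr ⟨by simp, h2⟩
    refine ⟨⟨u, hu⟩, ⟨⟨_, hv⟩, rfl, ?_⟩, rfl⟩
    rw [← column_apply σ ⟨u, hu⟩, ← column_apply σ ⟨_, hv⟩]
    exact hlt

/-- The triples `(i, j, m)` such that the cells `(i, j)`, `(i, j + 1)` and `(m, j)`, `i < m`, lie in
the diagram. -/
def triples (lam : Fin n → ℕ) : Finset (Fin n × ℕ × Fin n) :=
  (Finset.univ ×ˢ Finset.Icc 1 (numCols lam) ×ˢ Finset.univ).filter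
    fun x => x.1 < x.2.2 ∧ x.2.1 ≤ lam x.2.2

theorem mem_triples {x : Fin n × ℕ × Fin n} :
    x ∈ triples lam ↔ 1 ≤ x.2.1 ∧ x.1 < x.2.2 ∧ x.2.1 ≤ lam x.2.2 := by
  have := le_numCols lam x.2.2
  simp only [triples, Finset.mem_filter, Finset.mem_product, Finset.mem_univ, true_and,
    Finset.mem_Icc, and_true]
  constructor
  · rintro ⟨h1, h2, h3⟩
    exact ⟨h1.1, h2, h3⟩
  · rintro ⟨h1, h2, h3⟩
    exact ⟨⟨h1, by omega⟩, h2, h3⟩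

/-- Each cell `(m, j)` is the lower cell of one triple for every row above it. -/
theorem card_triples (lam : Fin n → ℕ) : (triples lam).card = nStat lam := by
  have hset : triples lam = Finset.univ.biUnion fun m : Fin n =>
      ((Finset.Iio m) ×ˢ (Finset.Icc 1 (lam m))).map
        ⟨fun y => (y.1, y.2, m), fun a b hab => by
          simp only [Prod.mk.injEq] at hab
          exact Prod.ext hab.1 hab.2.1⟩ := by
    ext ⟨i, j, m⟩
    simp only [mem_triples, Finset.mem_biUnion, Finset.mem_univ, true_and, Finset.mem_map,
      Finset.mem_product, Finset.mem_Iio, Finset.mem_Icc]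
    constructor
    · rintro ⟨h1, h2, h3⟩
      exact ⟨m, (i, j), ⟨h2, h1, h3⟩, rfl⟩
    · rintro ⟨m', y, ⟨h2, h1, h3⟩, ⟨⟩⟩
      exact ⟨h1, h2, h3⟩
  rw [hset, Finset.card_biUnion, nStat]
  · refine Finset.sum_congr rfl fun m _ => ?_
    rw [Finset.card_map, Finset.card_product, Fin.card_Iio, Nat.card_Icc, Nat.add_sub_cancel]
  · intro m _ m' _ hne
    rw [Function.onFun, Finset.disjoint_left]
    rintro ⟨i, j, k⟩ h1 h2
    simp only [Finset.mem_map] at h1 h2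
    obtain ⟨_, _, heq⟩ := h1
    obtain ⟨_, _, heq'⟩ := h2
    exact hne (congrArg (fun x => x.2.2) (heq.trans heq'.symm))

/-- An inversion lies either within a column or across adjacent columns. Strictness of `lam` puts
`(i, j)` and `(i, j + 1)` in the diagram whenever `(m, j)` is and `i < m`, so both kinds are indexed
by the same triples. -/
theorem card_Inv (h : StrictAnti lam) (σ : Filling lam) : (Inv σ).card =
    ((triples lam).filter fun x => column σ x.2.1 x.2.2 < column σ x.2.1 x.1).card +
    ((triples lam).filter fun x => column σ (x.2.1 + 1) x.1 < column σ x.2.1 x.2.2).card := by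
  classical
  rw [← Finset.card_filter_add_card_filter_not (s := Inv σ) (fun p => p.1.1.2 = p.2.1.2)]
  congr 1
  · refine Finset.card_bij (fun p _ => (p.1.1.1, p.1.1.2, p.2.1.1)) ?_ ?_ ?_
    · rintro ⟨u, v⟩ hp
      simp only [Inv, Finset.mem_filter, Finset.mem_univ, true_and] at hp
      obtain ⟨⟨hatt, hprec, hlt⟩, hcol⟩ := hp
      have hu := mem_diagram.mp u.2
      have hv := mem_diagram.mp v.2
      rw [← column_apply σ u, ← column_apply σ v, ← hcol] at hlt
      simp only [Finset.mem_filter, mem_triples]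
      refine ⟨⟨hu.1, ?_, hcol ▸ hv.2⟩, hlt⟩
      rcases hprec with hprec | hprec
      · omega
      · exact hprec.2
    · rintro ⟨u, v⟩ hp ⟨u', v'⟩ hp' heq
      simp only [Inv, Finset.mem_filter, Finset.mem_univ, true_and] at hp hp'
      simp only [Prod.mk.injEq] at heq
      refine Prod.ext (Subtype.ext (Prod.ext heq.1 heq.2.1)) (Subtype.ext (Prod.ext heq.2.2 ?_))
      simp only
      rw [← hp.2, ← hp'.2, heq.2.1]
    · rintro ⟨i, j, m⟩ hx
      simp only [Finset.mem_filter, mem_triples] at hx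
      obtain ⟨⟨h1, h2, h3⟩, hlt⟩ := hx
      have h4 := h h2
      have hu : (i, j) ∈ diagram lam := mem_diagram.mpr ⟨h1, by simp only; omega⟩
      have hv : (m, j) ∈ diagram lam := mem_diagram.mpr ⟨h1, h3⟩
      refine ⟨(⟨_, hu⟩, ⟨_, hv⟩), ?_, rfl⟩
      simp only [Inv, Finset.mem_filter, Finset.mem_univ, true_and, and_true]
      refine ⟨Or.inl ⟨rfl, h2.ne⟩, Or.inr ⟨rfl, h2⟩, ?_⟩
      rw [← column_apply σ ⟨_, hu⟩, ← column_apply σ ⟨_, hv⟩]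
      exact hlt
  -- The roles are exchanged here: the reading order puts `(m, j)` before `(i, j + 1)`, so the upper
  -- row comes from the second cell.
  · refine Finset.card_bij (fun p _ => (p.2.1.1, p.1.1.2, p.1.1.1)) ?_ ?_ ?_
    · rintro ⟨u, v⟩ hp
      simp only [Inv, Finset.mem_filter, Finset.mem_univ, true_and] at hp
      obtain ⟨⟨hatt, hprec, hlt⟩, hcol⟩ := hp
      have hu := mem_diagram.mp u.2
      have hv := mem_diagram.mp v.2
      have hnext : v.1.2 = u.1.2 + 1 ∧ v.1.1 < u.1.1 := by
        rcases hatt with hatt | hatt | hatt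
        · exact absurd hatt.1 hcol
        · rcases hprec with hprec | hprec
          · omega
          · exact absurd hprec.1 hcol
        · exact hatt
      rw [← column_apply σ u, ← column_apply σ v, hnext.1] at hlt
      simp only [Finset.mem_filter, mem_triples]
      exact ⟨⟨hu.1, hnext.2, hu.2⟩, hlt⟩
    · rintro ⟨u, v⟩ hp ⟨u', v'⟩ hp' heq
      simp only [Inv, Finset.mem_filter, Finset.mem_univ, true_and] at hp hp'
      simp only [Prod.mk.injEq] at heq
      have hnext : ∀ u v : {u : Fin n × ℕ // u ∈ diagram lam}, Attack u.1 v.1 →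
          Precedes u.1 v.1 → ¬ u.1.2 = v.1.2 → v.1.2 = u.1.2 + 1 := by
        rintro u v (hatt | hatt | hatt) (hprec | hprec) hne <;> omega
      refine Prod.ext (Subtype.ext (Prod.ext heq.2.2 heq.2.1)) (Subtype.ext (Prod.ext heq.1 ?_))
      simp only
      rw [hnext u v hp.1.1 hp.1.2.1 hp.2, hnext u' v' hp'.1.1 hp'.1.2.1 hp'.2, heq.2.1]
    · rintro ⟨i, j, m⟩ hx
      simp only [Finset.mem_filter, mem_triples] at hx
      obtain ⟨⟨h1, h2, h3⟩, hlt⟩ := hx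
      have h4 := h h2
      have hu : (m, j) ∈ diagram lam := mem_diagram.mpr ⟨h1, h3⟩
      have hv : (i, j + 1) ∈ diagram lam := mem_diagram.mpr ⟨by simp, by simp only; omega⟩
      refine ⟨(⟨_, hu⟩, ⟨_, hv⟩), ?_, rfl⟩
      simp only [Inv, Finset.mem_filter, Finset.mem_univ, true_and]
      refine ⟨⟨Or.inr (Or.inr ⟨rfl, h2⟩), Or.inl (Nat.lt_succ_self j), ?_⟩, by omega⟩
      rw [← column_apply σ ⟨_, hu⟩, ← column_apply σ ⟨_, hv⟩]
      exact hlt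

/-- The number of cells below `(i, j)` whose entry lies between those of `(i, j)` and
`(i, j + 1)`. -/
def cellBetween (σ : Filling lam) (u : Fin n × ℕ) : ℕ :=
  betweenCount (column σ u.2) u.1 (conj lam u.2) (column σ u.2 u.1) (column σ (u.2 + 1) u.1)

theorem sum_triples (h : StrictAnti lam) (f : Fin n → ℕ → Fin n → ℤ) :
    ∑ x ∈ triples lam, f x.1 x.2.1 x.2.2 =
      ∑ u ∈ innerCells lam, ∑ m, if u.1 < m ∧ m.val < conj lam u.2 then f u.1 u.2 m else 0 := by
  simp only [← Finset.sum_filter]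
  rw [Finset.sum_sigma']
  refine Finset.sum_bij' (fun x _ => ⟨(x.1, x.2.1), x.2.2⟩) (fun y _ => (y.1.1, y.1.2, y.2))
    ?_ ?_ ?_ ?_ ?_
  · rintro ⟨i, j, m⟩ hx
    simp only [mem_triples] at hx
    have := h hx.2.1
    simp only [Finset.mem_sigma, mem_innerCells, Finset.mem_filter, Finset.mem_univ, true_and,
      lt_conj_iff h]
    exact ⟨⟨hx.1, by omega⟩, hx.2⟩
  · rintro ⟨⟨i, j⟩, m⟩ hy
    simp only [Finset.mem_sigma, mem_innerCells, Finset.mem_filter, Finset.mem_univ, true_and,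
      lt_conj_iff h] at hy
    simp only [mem_triples]
    exact ⟨hy.1.1, hy.2⟩
  · intros; rfl
  · intros; rfl
  · intros; rfl

/-- Pointwise on triples this is `1 = [c < a] + [b < c] + [a < c < b] - [b < c < a]`, valid because
the nonattacking condition excludes `c = a` and `c = b`. -/
theorem nStat_eq (h : StrictAnti lam) (σ : Filling lam) (hσ : Nonattacking σ) :
    (nStat lam : ℤ) = (Inv σ).card + ∑ u ∈ innerCells lam,
      (if column σ u.2 u.1 < column σ (u.2 + 1) u.1 then (cellBetween σ u : ℤ)
        else -(cellBetween σ u : ℤ)) := by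
  have hbet : ∀ u ∈ innerCells lam,
      (if column σ u.2 u.1 < column σ (u.2 + 1) u.1 then (cellBetween σ u : ℤ)
        else -(cellBetween σ u : ℤ)) = ∑ m, if u.1 < m ∧ m.val < conj lam u.2 then
        ((if column σ u.2 u.1 < column σ u.2 m ∧ column σ u.2 m < column σ (u.2 + 1) u.1
          then (1 : ℤ) else 0) -
        (if column σ (u.2 + 1) u.1 < column σ u.2 m ∧ column σ u.2 m < column σ u.2 u.1
          then (1 : ℤ) else 0)) else 0 := by
    intro u _
    have hcount : (cellBetween σ u : ℤ) = ∑ m, if u.1 < m ∧ m.val < conj lam u.2 ∧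
        ((column σ u.2 u.1 < column σ u.2 m ∧ column σ u.2 m < column σ (u.2 + 1) u.1) ∨
        (column σ (u.2 + 1) u.1 < column σ u.2 m ∧ column σ u.2 m < column σ u.2 u.1))
          then (1 : ℤ) else 0 := by
      rw [Finset.sum_boole]
      rfl
    split_ifs with hlt
    · rw [hcount]
      refine Finset.sum_congr rfl fun m _ => ?_
      split_ifs <;> first | rfl | omega
    · rw [hcount, ← Finset.sum_neg_distrib]
      refine Finset.sum_congr rfl fun m _ => ?_
      split_ifs <;> first | rfl | omega
  rw [Finset.sum_congr rfl hbet, ← sum_triples h fun i j m =>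
      ((if column σ j i < column σ j m ∧ column σ j m < column σ (j + 1) i
          then (1 : ℤ) else 0) -
        (if column σ (j + 1) i < column σ j m ∧ column σ j m < column σ j i
          then (1 : ℤ) else 0)), card_Inv h, ← card_triples]
  rw [Finset.card_filter, Finset.card_filter, Finset.card_eq_sum_ones]
  push_cast
  rw [← Finset.sum_add_distrib, ← Finset.sum_add_distrib]
  refine Finset.sum_congr rfl ?_
  rintro ⟨i, j, m⟩ hx
  simp only [mem_triples] at hx
  obtain ⟨h1, h2, h3⟩ := hx
  have h4 := h h2
  have hij : (i, j) ∈ diagram lam := mem_diagram.mpr ⟨h1, by simp only; omega⟩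
  have hmj : (m, j) ∈ diagram lam := mem_diagram.mpr ⟨h1, h3⟩
  have hij' : (i, j + 1) ∈ diagram lam := mem_diagram.mpr ⟨by simp, by simp only; omega⟩
  have hne1 : column σ j i ≠ column σ j m := by
    rw [column, column, dif_pos hij, dif_pos hmj]
    exact hσ ⟨_, hij⟩ ⟨_, hmj⟩ (Or.inl ⟨rfl, h2.ne⟩)
  have hne2 : column σ (j + 1) i ≠ column σ j m := by
    rw [column, column, dif_pos hij', dif_pos hmj]
    exact hσ ⟨_, hij'⟩ ⟨_, hmj⟩ (Or.inr (Or.inl ⟨rfl, h2⟩))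
  simp only
  split_ifs <;> first | rfl | omega

/-- With rows numbered from `0`, the height of column `j` minus the row index is `leg + 1`. At a
descent the exponent `d - 1 - N` of `rowCoeff` thus becomes `leg - N`, the leg being the term
subtracted in `inv`. -/
theorem cellCoeff_eq (h : StrictAnti lam) (q t : K) (σ : Filling lam)
    {u : Fin n × ℕ} (hu : u ∈ innerCells lam) :
    cellCoeff q t σ u.1 u.2 =
      t ^ ((if column σ u.2 u.1 < column σ (u.2 + 1) u.1 then (cellBetween σ u : ℤ)
        else -(cellBetween σ u : ℤ)) +
        (if column σ (u.2 + 1) u.1 < column σ u.2 u.1 then (leg lam u : ℤ) else 0)) *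
      q ^ (if column σ (u.2 + 1) u.1 < column σ u.2 u.1 then arm lam u else 0) *
      (if column σ u.2 u.1 ≠ column σ (u.2 + 1) u.1 then
        (1 - t) / (1 - q ^ arm lam u * t ^ (leg lam u + 1)) else 1) := by
  rw [mem_innerCells] at hu
  have hlt : u.1.val < conj lam u.2 := (lt_conj_iff h).mpr (by omega)
  have hleg : leg lam u = conj lam u.2 - (u.1.val + 1) := leg_eq h u.1 hu.1
  have hd : conj lam u.2 - u.1.val = leg lam u + 1 := by omega
  have hcell : cellCoeff q t σ u.1 u.2 = rowCoeff (q ^ arm lam u) t (conj lam u.2 - u.1.val)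
    (cellBetween σ u) (column σ u.2 u.1) (column σ (u.2 + 1) u.1) := rfl
  rw [hcell, hd]
  rcases lt_trichotomy (column σ u.2 u.1) (column σ (u.2 + 1) u.1) with hc | hc | hc
  · rw [rowCoeff_of_lt _ _ _ _ hc, if_pos hc, if_neg hc.not_gt, if_neg hc.not_gt, if_pos hc.ne]
    simp
  · have hzero : cellBetween σ u = 0 := by
      rw [cellBetween, betweenCount, Finset.card_eq_zero, Finset.filter_eq_empty_iff]
      intro m _
      omega
    rw [hzero, hc, rowCoeff_self]
    simp
  · rw [rowCoeff_of_gt _ _ _ _ hc, if_neg hc.not_gt, if_pos hc, if_pos hc, if_pos hc.ne']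
    congr 3
    push_cast
    ring

theorem prod_cellCoeff (h : StrictAnti lam) {q t : K} (ht : t ≠ 0) (σ : Filling lam)
    (hσ : Nonattacking σ) :
    ∏ u ∈ innerCells lam, cellCoeff q t σ u.1 u.2 =
      t ^ ((nStat lam : ℤ) - inv σ) * q ^ maj σ *
        ∏ u ∈ Diff σ, (1 - t) / (1 - q ^ arm lam u.1 * t ^ (leg lam u.1 + 1)) := by
  have hmaj : maj σ = ∑ u ∈ innerCells lam,
      if column σ (u.2 + 1) u.1 < column σ u.2 u.1 then arm lam u else 0 := by
    rw [← Finset.sum_filter, ← map_Des, Finset.sum_map]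
    rfl
  have hleg : ∑ u ∈ Des σ, (leg lam u.1 : ℤ) = ∑ u ∈ innerCells lam,
      if column σ (u.2 + 1) u.1 < column σ u.2 u.1 then (leg lam u : ℤ) else 0 := by
    rw [← Finset.sum_filter, ← map_Des, Finset.sum_map]
    rfl
  have hdiff : ∏ u ∈ Diff σ, (1 - t) / (1 - q ^ arm lam u.1 * t ^ (leg lam u.1 + 1)) =
      ∏ u ∈ innerCells lam, if column σ u.2 u.1 ≠ column σ (u.2 + 1) u.1 then
        (1 - t) / (1 - q ^ arm lam u * t ^ (leg lam u + 1)) else 1 := by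
    rw [← Finset.prod_filter, ← map_Diff, Finset.prod_map]
    rfl
  have hexp : (nStat lam : ℤ) - inv σ = ∑ u ∈ innerCells lam,
      ((if column σ u.2 u.1 < column σ (u.2 + 1) u.1 then (cellBetween σ u : ℤ)
        else -(cellBetween σ u : ℤ)) +
        (if column σ (u.2 + 1) u.1 < column σ u.2 u.1 then (leg lam u : ℤ) else 0)) := by
    rw [inv, hleg, nStat_eq h σ hσ, Finset.sum_add_distrib]
    ring
  have hzpow : ∀ (s : Finset (Fin n × ℕ)) (f : Fin n × ℕ → ℤ),
      t ^ (∑ u ∈ s, f u) = ∏ u ∈ s, t ^ f u := by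
    intro s f
    induction s using Finset.cons_induction with
    | empty => simp
    | cons a s ha ih => rw [Finset.sum_cons, Finset.prod_cons, zpow_add₀ ht, ih]
  rw [Finset.prod_congr rfl fun u hu => cellCoeff_eq h q t σ hu, hexp, hmaj, hdiff, hzpow,
    ← Finset.prod_pow_eq_pow_sum, ← Finset.prod_mul_distrib, ← Finset.prod_mul_distrib]

/-! ### The summation formula and nonemptiness of the fibre -/

theorem sum_fibre_weight (h : StrictAnti lam) {q t : K} (ht : t ≠ 0)
    (hqt : ∀ a b : ℕ, 1 ≤ a → 1 ≤ b → q ^ a * t ^ b ≠ 1)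
    (σ : Filling lam) (hσ : Nonattacking σ) :
    ∑ P ∈ fibre σ, weight q t P.1 P.2 =
      t ^ ((nStat lam : ℤ) - inv σ) * q ^ maj σ *
        ∏ u ∈ Diff σ, (1 - t) / (1 - q ^ arm lam u.1 * t ^ (leg lam u.1 + 1)) := by
  rw [sum_fibre_eq_prod h ht hqt σ hσ, prod_innerCells lam (cellCoeff q t σ),
    prod_cellCoeff h ht σ hσ]

/-- The fibre is nonempty because the sum of its weights does not vanish at `q = t = 2`. -/
theorem fibre_nonempty (h : StrictAnti lam) (σ : Filling lam) (hσ : Nonattacking σ) :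
    (fibre σ).Nonempty := by
  by_contra hempty
  rw [Finset.not_nonempty_iff_eq_empty] at hempty
  have hone : ∀ a b : ℕ, 1 ≤ b → (1 : ℚ) < 2 ^ a * 2 ^ b := by
    intro a b hb
    rw [← pow_add]
    exact one_lt_pow₀ (by norm_num) (by omega)
  have hsum := sum_fibre_weight (K := ℚ) (q := 2) (t := 2) h (by norm_num)
    (fun a b _ hb => (hone a b hb).ne') σ hσ
  rw [hempty, Finset.sum_empty] at hsum
  refine mul_ne_zero (mul_ne_zero (zpow_ne_zero _ (by norm_num)) (pow_ne_zero _ (by norm_num)))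
    (Finset.prod_ne_zero_iff.mpr fun u _ => div_ne_zero (by norm_num) ?_) hsum.symm
  exact sub_ne_zero.mpr (hone _ _ (by omega)).ne

end RamYip

theorem theorem3p5 {n : ℕ} (lam : Fin n → ℕ) (hlam : RamYip.IsRegular lam)
    {K : Type*} [Field K] (q t : K) (ht : t ≠ 0)
    (hqt : ∀ a b : ℕ, 1 ≤ a → 1 ≤ b → q ^ a * t ^ b ≠ 1)
    (σ : RamYip.Filling lam) (hσ : RamYip.Nonattacking σ) :
    (RamYip.fibre σ).Nonempty ∧
    (∀ P ∈ RamYip.fibre σ, RamYip.permAct P.1 (RamYip.mu P.2) = RamYip.content σ) ∧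
    ∑ P ∈ RamYip.fibre σ, RamYip.weight q t P.1 P.2 =
      t ^ ((RamYip.nStat lam : ℤ) - RamYip.inv σ) * q ^ RamYip.maj σ *
        ∏ u ∈ RamYip.Diff σ,
          (1 - t) / (1 - q ^ RamYip.arm lam u.1 * t ^ (RamYip.leg lam u.1 + 1)) := by
  refine ⟨RamYip.fibre_nonempty hlam.1 σ hσ, fun P hP => ?_,
    RamYip.sum_fibre_weight hlam.1 ht hqt σ hσ⟩
  rw [RamYip.permAct_mu hlam.1, (Finset.mem_filter.mp hP).2]
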